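/- Let $U$, $V$, $V_1$ be real-valued functions in $L^\infty(\mathbb R)$ with compact support, and let $V_\lambda$ ($\lambda>0$) be real-valued functions in $L^2(\mathbb R)$ which, for all small $\lambda>0$, are supported in one fixed bounded interval and satisfy $\|V_\lambda-V-\lambda V_1\|_{L^2(\mathbb R)}=o(\lambda)$ as $\lambda\to 0^+$. Let $H_\lambda=-\frac{d^2}{dx^2}+U+\lambda V_\lambda$ in $L^2(\mathbb R)$ with domain $W_2^2(\mathbb R)$. Solutions of differential equations below are $C^1$ functions on $\mathbb R$ with locally absolutely continuous derivative, satisfying the equation almost everywhere. Suppose that $-\frac{d^2}{dx^2}+U$ has a zero-energy resonance, i.e. $-u''+Uu=0$ has a nontrivial solution $u$ bounded on $\mathbb R$ (a half-bound state), normalized by $\lim_{x\to-\infty}u(x)=1$. Suppose that $\int_{\mathbb R}Vu^2\,dx<0$. Then: (i) For all small $\lambda>0$ the operator $H_\lambda$ has a negative eigenvalue $e_\lambda$ such that $e_\lambda\to0$ as $\lambda\to0^+$. (ii) The limit $\theta=\lim_{x\to+\infty}u(x)$ exists and is nonzero. Put $\Theta(x)=1$ for $x<0$ and $\Theta(x)=\theta$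 for $x>0$. Let $u_1$ be the solution of $-u_1''+Uu_1=0$ with $u_1(x)=x$ for all sufficiently negative $x$, and let $v_*$ be the solution of $-v_*''+Uv_*=-Vu$ with $v_*(x)=0$ for all sufficiently negative $x$. Then there is a constant $\theta_1$ such that $u_1(x)=\theta^{-1}x+\theta_1$ for all sufficiently large $x$, and every family $e_\lambda$ as in (i) satisfies $$e_\lambda=-\lambda^2\bigl(\omega_0+\omega_1\lambda+o(\lambda)\bigr)^2\qquad(\lambda\to0^+),$$ where $$\omega_0=\frac1{\theta^2+1}\int_{\mathbb R}Vu^2\,dx,$$ $$\omega_1=\frac1{\theta^2+1}\Bigl(\int_{\mathbb R}V\bigl(v_*+\omega_0(\theta^2-1)u_1\bigr)u\,dx+\omega_0^2\int_{\mathbb R}(u^2-\Theta^2)\,dx-\omega_0^2\theta^3\theta_1+\int_{\mathbb R}V_1u^2\,dx\Bigr).$$ -/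

import Mathlib

open MeasureTheory Filter Topology Asymptotics

noncomputable section

/-- `f` is absolutely continuous on every compact interval of the real line. -/
def LocallyAC {E : Type*} [NormedAddCommGroup E] (f : ℝ → E) : Prop :=
  ∀ a b : ℝ, AbsolutelyContinuousOnInterval f a b

/-- `f` vanishes almost everywhere outside the interval `[-ℓ, ℓ]`. -/
def EssSupportedIn (f : ℝ → ℝ) (ℓ : ℝ) : Prop :=
  ∀ᵐ x : ℝ, ℓ < |x| → f x = 0

/-- An essentially bounded measurable function of compact (essential) support on the line. -/
def BoundedCompactlySupported (f : ℝ → ℝ) : Prop :=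
  MemLp f ⊤ volume ∧ ∃ ℓ : ℝ, EssSupportedIn f ℓ

/-- `y` is a solution on the whole line of `-y'' + U y = f`: it is continuously differentiable,
`y'` is locally absolutely continuous, and the equation holds almost everywhere. -/
structure IsSolution (U f y : ℝ → ℝ) : Prop where
  differentiable : Differentiable ℝ y
  deriv_ac : LocallyAC (deriv y)
  eqn : ∀ᵐ x : ℝ, -deriv (deriv y) x + U x * y x = f x

/-- `u` is a half-bound state of `-d²/dx² + U`: a nontrivial solution of `-u'' + U u = 0` that is
bounded on the whole line. The operator has a zero-energy resonance if such a `u` exists. -/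
structure IsHalfBoundState (U u : ℝ → ℝ) : Prop where
  solution : IsSolution U 0 u
  nontrivial : u ≠ 0
  bounded : ∃ C : ℝ, ∀ x, |u x| ≤ C

/-- A half-bound state is normalized if it tends to `1` at `-∞`. -/
structure IsNormalizedHalfBoundState (U u : ℝ → ℝ) : Prop extends IsHalfBoundState U u where
  normalized : Tendsto u atBot (𝓝 1)

/-- `ψ` is (the continuously differentiable representative of) an element of the complex Sobolev
space `W₂²(ℝ)`: `ψ'` is locally absolutely continuous and `ψ`, `ψ'`, `ψ''` are in `L²(ℝ)`. -/
structure MemW22 (ψ : ℝ → ℂ) : Prop where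
  differentiable : Differentiable ℝ ψ
  deriv_ac : LocallyAC (deriv ψ)
  memLp : MemLp ψ 2 volume
  memLp_deriv : MemLp (deriv ψ) 2 volume
  memLp_deriv_deriv : MemLp (deriv (deriv ψ)) 2 volume

/-- The real number `e` is an eigenvalue of the operator `-d²/dx² + q` in `L²(ℝ; ℂ)` with domain
`W₂²(ℝ)`: the equation `-ψ'' + q ψ = e ψ` has a nonzero solution in the domain. -/
def IsSchrodingerEigenvalue (q : ℝ → ℝ) (e : ℝ) : Prop :=
  ∃ ψ : ℝ → ℂ, MemW22 ψ ∧ ¬ (ψ =ᵐ[volume] 0) ∧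
    ∀ᵐ x : ℝ, -deriv (deriv ψ) x + (q x : ℂ) * ψ x = (e : ℂ) * ψ x

/-- For a family of potentials `q lam`, `lam > 0`: for all small positive `lam` the number `e lam`
is a negative eigenvalue of `-d²/dx² + q lam`, and `e lam → 0` as `lam → 0`. -/
structure IsThresholdEigenvalue (q : ℝ → ℝ → ℝ) (e : ℝ → ℝ) : Prop where
  eigenvalue : ∀ᶠ lam in 𝓝[>] (0 : ℝ), e lam < 0 ∧ IsSchrodingerEigenvalue (q lam) (e lam)
  tendsto : Tendsto e (𝓝[>] (0 : ℝ)) (𝓝 0)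

/-- The step function equal to `1` on the left half-line and to `θ` on the right one. -/
def stepTheta (θ : ℝ) (x : ℝ) : ℝ := if x < 0 then 1 else θ

/-- `ω₀ = (θ² + 1)⁻¹ ∫ V u²`. -/
def omega0 (V u : ℝ → ℝ) (θ : ℝ) : ℝ :=
  1 / (θ ^ 2 + 1) * ∫ x, V x * u x ^ 2

/-- `ω₁ = (θ² + 1)⁻¹ (∫ V (v_* + ω₀ (θ² - 1) u₁) u + ω₀² ∫ (u² - Θ²) - ω₀² θ³ θ₁ + ∫ V₁ u²)`. -/
def omega1 (V V₁ u u₁ vs : ℝ → ℝ) (θ θ₁ : ℝ) : ℝ :=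
  1 / (θ ^ 2 + 1) *
    ((∫ x, V x * (vs x + omega0 V u θ * (θ ^ 2 - 1) * u₁ x) * u x)
      + omega0 V u θ ^ 2 * (∫ x, (u x ^ 2 - stepTheta θ x ^ 2))
      - omega0 V u θ ^ 2 * θ ^ 3 * θ₁
      + ∫ x, V₁ x * u x ^ 2)

end

/-!
Write the eigenvalue as `-κ²` with `κ > 0`. Outside an interval `[-ℓ, ℓ]` carrying all potentials,
an eigenfunction is a multiple of `exp (κ x)` on the left and of `exp (-κ x)` on the right, so
`-κ²` is an eigenvalue iff the solution `y` with `y(-ℓ) = 1`, `y'(-ℓ) = κ` satisfies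
`y'(ℓ) + κ y(ℓ) = 0` (`jostFun_eq_zero_of_eigenvalue`, `isSchrodingerEigenvalue_of_end_condition`).
The half-bound state `u` equals `1` on the left and `θ` on the right of the interval, and its
Wronskian with `y` turns this condition into

  `κ (1 + θ y(ℓ) + κ ∫ y u) + lam ∫ V_lam y u = 0`,  integrals over `[-ℓ, ℓ]`,

whose left side is `jostFun` (`jostFun_eq`).

The initial value problem is the Volterra equation `y = 1 + κ (x + ℓ) + K_{U + lam V_lam + κ²} y`
in a space of bounded continuous functions, where `K_q` depends linearly and continuously on
`q ∈ L²(-ℓ, ℓ)`. Since `U` is bounded, `K_U` is quasi-nilpotent and `1 - K_U` is invertible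
(`isUnit_one_sub_volterra`); so are its small perturbations, and existence, uniqueness and
continuous dependence of `y` on `(lam, κ)` follow from continuity of inversion in a Banach algebra.
In particular `y → u` as `(lam, κ) → 0`.

At leading order the equation is `κ (1 + θ²) + lam ∫ V u² = 0`, which gives a zero
`κ ≈ -ω₀ lam > 0` by the intermediate value theorem (`exists_jostFun_eq_zero`) and forces
`κ / lam → -ω₀` for every small zero (`tendsto_zero_div`). Along such zeros `(y - u) / lam`
converges uniformly to `-ω₀ (u₁ + ℓ u) + v_*`, and inserting this gives the next coefficient
(`tendsto_zero_second`). The values of `u₁` and `v_*` at `ℓ`, computed from Wronskians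
(`boundary_values`), bring it to the form `ω₁`, in which `ℓ` no longer appears.
-/

noncomputable section

open BoundedContinuousFunction

/-! ### The Volterra operator on an interval -/

/-- The metric projection of the line onto `[-ℓ, ℓ]`. -/
def clamp (ℓ x : ℝ) : ℝ := max (-ℓ) (min x ℓ)

theorem clamp_of_mem {ℓ x : ℝ} (h₁ : -ℓ ≤ x) (h₂ : x ≤ ℓ) : clamp ℓ x = x := by
  rw [clamp, min_eq_left h₂, max_eq_right h₁]

theorem abs_clamp_le (ℓ x : ℝ) : |clamp ℓ x| ≤ |ℓ| := by
  unfold clamp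
  grind

theorem neg_le_clamp (ℓ x : ℝ) : -ℓ ≤ clamp ℓ x := le_max_left _ _

theorem clamp_le {ℓ : ℝ} (hℓ : 0 ≤ ℓ) (x : ℝ) : clamp ℓ x ≤ ℓ := by
  unfold clamp
  grind

theorem abs_clamp_sub_clamp_le (ℓ x y : ℝ) : |clamp ℓ x - clamp ℓ y| ≤ |x - y| := by
  unfold clamp
  grind

@[fun_prop]
theorem continuous_clamp (ℓ : ℝ) : Continuous (clamp ℓ) := by
  unfold clamp
  fun_prop

/-- Lebesgue measure on `[-ℓ, ℓ]`. -/
abbrev slab (ℓ : ℝ) : Measure ℝ := volume.restrict (Set.Ioc (-ℓ) ℓ)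

/-- The kernel `(x - t)⁺` on `[-ℓ, ℓ]`, as a bounded continuous function of `t`. -/
def kern (ℓ x : ℝ) : ℝ →ᵇ ℝ :=
  BoundedContinuousFunction.ofNormedAddCommGroup (fun t => max (clamp ℓ x - clamp ℓ t) 0)
    (by fun_prop) (2 * |ℓ|) (fun t => by
      have h₁ := abs_le.1 (abs_clamp_le ℓ x)
      have h₂ := abs_le.1 (abs_clamp_le ℓ t)
      rw [Real.norm_eq_abs, abs_of_nonneg (le_max_right _ _)]
      exact max_le (by linarith) (by positivity))

theorem kern_apply (ℓ x t : ℝ) : kern ℓ x t = max (clamp ℓ x - clamp ℓ t) 0 := rfl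

theorem norm_kern_le (ℓ x : ℝ) : ‖kern ℓ x‖ ≤ 2 * |ℓ| :=
  BoundedContinuousFunction.norm_ofNormedAddCommGroup_le _ (by positivity) _

theorem continuous_kern (ℓ : ℝ) : Continuous (kern ℓ) := by
  refine (LipschitzWith.of_dist_le_mul (K := 1) fun x y => ?_).continuous
  rw [NNReal.coe_one, one_mul]
  refine (BoundedContinuousFunction.dist_le dist_nonneg).2 fun t => ?_
  rw [kern_apply, kern_apply, Real.dist_eq, Real.dist_eq]
  have := abs_clamp_sub_clamp_le ℓ x y
  grind

/-- A shortcut to the norm on bounded continuous functions, for instance search in spaces of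
operators. -/
instance instNormedAddCommGroupBCF : NormedAddCommGroup (ℝ →ᵇ ℝ) := inferInstance

/-- A shortcut to the normed space of bounded continuous functions, for instance search in spaces
of operators. -/
instance instNormedSpaceBCF : NormedSpace ℝ (ℝ →ᵇ ℝ) := inferInstance

/-- The pairing `(q, f) ↦ ∫ q f` of square integrable and bounded continuous functions on
`[-ℓ, ℓ]`. -/
def pairing (ℓ : ℝ) : Lp ℝ 2 (slab ℓ) →L[ℝ] (ℝ →ᵇ ℝ) →L[ℝ] ℝ :=
  ((innerSL ℝ (E := Lp ℝ 2 (slab ℓ))).flip.comp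
    (BoundedContinuousFunction.toLp 2 (slab ℓ) ℝ)).flip

theorem pairing_apply (ℓ : ℝ) (q : Lp ℝ 2 (slab ℓ)) (f : ℝ →ᵇ ℝ) :
    pairing ℓ q f = ∫ t, q t * f t ∂slab ℓ := by
  change inner ℝ q (BoundedContinuousFunction.toLp 2 (slab ℓ) ℝ f) = _
  rw [L2.inner_def]
  refine integral_congr_ae ?_
  filter_upwards [BoundedContinuousFunction.coeFn_toLp (p := 2) (μ := slab ℓ) ℝ f] with t ht
  rw [ht]
  simp [mul_comm]

theorem norm_pairing_kern_mul_le (ℓ : ℝ) (q : Lp ℝ 2 (slab ℓ)) (y : ℝ →ᵇ ℝ) (x : ℝ) :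
    ‖pairing ℓ q (kern ℓ x * y)‖ ≤ ‖pairing ℓ‖ * (2 * |ℓ|) * ‖q‖ * ‖y‖ := by
  calc ‖pairing ℓ q (kern ℓ x * y)‖ ≤ ‖pairing ℓ‖ * ‖q‖ * ‖kern ℓ x * y‖ :=
        (pairing ℓ).le_opNorm₂ _ _
    _ ≤ ‖pairing ℓ‖ * ‖q‖ * ((2 * |ℓ|) * ‖y‖) := by
        gcongr
        exact (norm_mul_le _ _).trans (by gcongr; exact norm_kern_le ℓ x)
    _ = _ := by ring

/-- The Volterra operator `(q, y) ↦ ∫_{-ℓ}^x (x - t) q(t) y(t) dt` on `[-ℓ, ℓ]`. Functions on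
`[-ℓ, ℓ]` are encoded as functions on the line that are constant on either side, so that the
operator acts on bounded continuous functions of a real variable. -/
def volterra (ℓ : ℝ) : Lp ℝ 2 (slab ℓ) →L[ℝ] (ℝ →ᵇ ℝ) →L[ℝ] (ℝ →ᵇ ℝ) :=
  LinearMap.mkContinuous₂
    (LinearMap.mk₂ ℝ
      (fun q y => BoundedContinuousFunction.ofNormedAddCommGroup
        (fun x => pairing ℓ q (kern ℓ x * y))
        ((pairing ℓ q).continuous.comp ((continuous_kern ℓ).mul continuous_const))
        (‖pairing ℓ‖ * (2 * |ℓ|) * ‖q‖ * ‖y‖) (norm_pairing_kern_mul_le ℓ q y))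
      (fun q₁ q₂ y => by ext x; simp)
      (fun c q y => by ext x; simp)
      (fun q y₁ y₂ => by ext x; simp [mul_add])
      (fun c q y => by ext x; simp [mul_smul_comm]))
    (‖pairing ℓ‖ * (2 * |ℓ|))
    (fun q y => BoundedContinuousFunction.norm_ofNormedAddCommGroup_le _ (by positivity)
      (norm_pairing_kern_mul_le ℓ q y))

theorem volterra_apply (ℓ : ℝ) (q : Lp ℝ 2 (slab ℓ)) (y : ℝ →ᵇ ℝ) (x : ℝ) :
    volterra ℓ q y x = pairing ℓ q (kern ℓ x * y) := rfl

theorem volterra_apply_eq_integral (ℓ : ℝ) (q : Lp ℝ 2 (slab ℓ)) (y : ℝ →ᵇ ℝ) (x : ℝ) :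
    volterra ℓ q y x = ∫ t, q t * (kern ℓ x t * y t) ∂slab ℓ := by
  rw [volterra_apply, pairing_apply]
  rfl

/-- The function `x + ℓ` on `[-ℓ, ℓ]`, extended by constants. -/
def ramp (ℓ : ℝ) : ℝ →ᵇ ℝ :=
  BoundedContinuousFunction.ofNormedAddCommGroup (fun t => clamp ℓ t + ℓ)
    (by fun_prop) (2 * |ℓ|) (fun t => by
      have h₁ := abs_clamp_le ℓ t
      have h₂ := abs_add_le (clamp ℓ t) ℓ
      rw [Real.norm_eq_abs]
      linarith)

theorem ramp_apply (ℓ t : ℝ) : ramp ℓ t = clamp ℓ t + ℓ := rfl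

/-- The restriction of a continuous function to `[-ℓ, ℓ]`, extended by constants. -/
def restr (ℓ : ℝ) (y : ℝ → ℝ) (hy : Continuous y) : ℝ →ᵇ ℝ :=
  BoundedContinuousFunction.mkOfBound ⟨fun x => y (clamp ℓ x), by fun_prop⟩
    (Metric.diam (y '' Set.Icc (-|ℓ|) |ℓ|)) (fun a b =>
      Metric.dist_le_diam_of_mem (isCompact_Icc.image hy).isBounded
        (Set.mem_image_of_mem _ (abs_le.1 (abs_clamp_le ℓ a)))
        (Set.mem_image_of_mem _ (abs_le.1 (abs_clamp_le ℓ b))))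

theorem restr_apply (ℓ : ℝ) (y : ℝ → ℝ) (hy : Continuous y) (x : ℝ) :
    restr ℓ y hy x = y (clamp ℓ x) := rfl

/-- Almost every point for the measure on the interval lies in the interval. -/
theorem ae_slab_mem (ℓ : ℝ) : ∀ᵐ t ∂slab ℓ, t ∈ Set.Ioc (-ℓ) ℓ :=
  ae_restrict_mem measurableSet_Ioc

theorem ae_slab_clamp (ℓ : ℝ) : ∀ᵐ t ∂slab ℓ, clamp ℓ t = t := by
  filter_upwards [ae_slab_mem ℓ] with t ht using clamp_of_mem ht.1.le ht.2

theorem integral_slab_eq_intervalIntegral {ℓ : ℝ} (hℓ : 0 ≤ ℓ) (f : ℝ → ℝ) :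
    ∫ t, f t ∂slab ℓ = ∫ t in (-ℓ)..ℓ, f t := by
  rw [intervalIntegral.integral_of_le (by linarith)]

/-- Integration against the kernel is the Volterra integral `∫_{-ℓ}^x (x - t) f(t) dt`. -/
theorem integral_kern_mul {ℓ x : ℝ} (h₁ : -ℓ ≤ x) (h₂ : x ≤ ℓ) (f : ℝ → ℝ) :
    ∫ t, kern ℓ x t * f t ∂slab ℓ = ∫ t in (-ℓ)..x, (x - t) * f t := by
  rw [intervalIntegral.integral_of_le h₁, ← integral_indicator measurableSet_Ioc,
    ← integral_indicator measurableSet_Ioc]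
  congr 1
  ext t
  by_cases ht : t ∈ Set.Ioc (-ℓ) x
  · have ht' : t ∈ Set.Ioc (-ℓ) ℓ := ⟨ht.1, ht.2.trans h₂⟩
    rw [Set.indicator_of_mem ht, Set.indicator_of_mem ht', kern_apply, clamp_of_mem h₁ h₂,
      clamp_of_mem ht'.1.le ht'.2, max_eq_left (by linarith [ht.2])]
  · rw [Set.indicator_of_notMem ht]
    by_cases ht' : t ∈ Set.Ioc (-ℓ) ℓ
    · rw [Set.indicator_of_mem ht', kern_apply, clamp_of_mem h₁ h₂,
        clamp_of_mem ht'.1.le ht'.2, max_eq_right, zero_mul]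
      by_contra! h
      exact ht ⟨ht'.1, by linarith⟩
    · rw [Set.indicator_of_notMem ht']

theorem integrable_Lp_mul {ℓ : ℝ} (q : Lp ℝ 2 (slab ℓ)) (f : ℝ →ᵇ ℝ) :
    Integrable (fun t => q t * f t) (slab ℓ) := by
  have h : Integrable (fun t => q t) (slab ℓ) :=
    (Lp.memLp q).integrable (by norm_num)
  exact h.mul_bdd (c := ‖f‖) f.continuous.aestronglyMeasurable
    (Eventually.of_forall fun t => f.norm_coe_le_norm t)

theorem integrable_mul_bcf {ℓ : ℝ} {g : ℝ → ℝ} (hg : Integrable g (slab ℓ)) (f : ℝ →ᵇ ℝ) :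
    Integrable (fun t => g t * f t) (slab ℓ) :=
  hg.mul_bdd (c := ‖f‖) f.continuous.aestronglyMeasurable
    (Eventually.of_forall fun t => f.norm_coe_le_norm t)

theorem kern_clamp (ℓ x : ℝ) (hℓ : 0 ≤ ℓ) : kern ℓ (clamp ℓ x) = kern ℓ x := by
  ext t
  rw [kern_apply, kern_apply, clamp_of_mem (neg_le_clamp _ _) (clamp_le hℓ _)]

theorem kern_nonneg (ℓ x t : ℝ) : 0 ≤ kern ℓ x t := le_max_right _ _

theorem abs_volterra_pow_apply_le {ℓ M : ℝ} (hℓ : 0 ≤ ℓ) (hM₀ : 0 ≤ M) {q : Lp ℝ 2 (slab ℓ)}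
    (hM : ∀ᵐ t ∂slab ℓ, |q t| ≤ M) (y : ℝ →ᵇ ℝ) (n : ℕ) (x : ℝ) :
    |(volterra ℓ q ^ n) y x| ≤ ‖y‖ * (2 * ℓ * M) ^ n * (ramp ℓ x ^ n / n.factorial) := by
  induction n generalizing x with
  | zero => simpa using y.norm_coe_le_norm x
  | succ n ih =>
    set B : ℝ := ‖y‖ * (2 * ℓ * M) ^ n / n.factorial with hB
    have hB₀ : 0 ≤ B := by positivity
    set c := clamp ℓ x with hc
    have hc₁ : -ℓ ≤ c := neg_le_clamp _ _
    have hc₂ : c ≤ ℓ := clamp_le hℓ _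
    rw [pow_succ', mul_apply_eq_comp, volterra_apply_eq_integral,
      ← kern_clamp ℓ x hℓ, ← hc]
    have step₁ : |∫ t, q t * (kern ℓ c t * (volterra ℓ q ^ n) y t) ∂slab ℓ|
        ≤ ∫ t, kern ℓ c t * (M * (B * (t + ℓ) ^ n)) ∂slab ℓ := by
      refine norm_integral_le_of_norm_le (f := fun t =>
        q t * (kern ℓ c t * (volterra ℓ q ^ n) y t)) ?_ ?_
      · have : Continuous fun t => kern ℓ c t * (M * (B * (t + ℓ) ^ n)) := by fun_prop
        exact this.integrableOn_Ioc
      · filter_upwards [hM, ae_slab_clamp ℓ] with t ht₁ ht₂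
        have h := ih t
        rw [ramp_apply, ht₂] at h
        rw [norm_mul, norm_mul, Real.norm_eq_abs, Real.norm_eq_abs, Real.norm_eq_abs,
          abs_of_nonneg (kern_nonneg _ _ _)]
        have h' : |(volterra ℓ q ^ n) y t| ≤ B * (t + ℓ) ^ n := h.trans_eq (by rw [hB]; ring)
        calc |q t| * (kern ℓ c t * |(volterra ℓ q ^ n) y t|)
            ≤ M * (kern ℓ c t * (B * (t + ℓ) ^ n)) := by
              have h₀ := kern_nonneg ℓ c t
              gcongr
          _ = _ := by ring
    have step₂ : ∫ t in (-ℓ)..c, (c - t) * (M * (B * (t + ℓ) ^ n))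
        ≤ ∫ t in (-ℓ)..c, 2 * ℓ * M * B * (t + ℓ) ^ n := by
      refine intervalIntegral.integral_mono_on hc₁
        (Continuous.intervalIntegrable (by fun_prop) _ _)
        (Continuous.intervalIntegrable (by fun_prop) _ _) fun t ht => ?_
      have h₀ : 0 ≤ t + ℓ := by linarith [ht.1]
      calc (c - t) * (M * (B * (t + ℓ) ^ n)) ≤ 2 * ℓ * (M * (B * (t + ℓ) ^ n)) := by
            gcongr
            linarith [ht.1]
        _ = _ := by ring
    have step₃ : ∫ t in (-ℓ)..c, 2 * ℓ * M * B * (t + ℓ) ^ n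
        = 2 * ℓ * M * B * ((c + ℓ) ^ (n + 1) / (n + 1)) := by
      rw [intervalIntegral.integral_const_mul,
        intervalIntegral.integral_comp_add_right (fun t => t ^ n), integral_pow]
      simp
    rw [integral_kern_mul hc₁ hc₂] at step₁
    refine (step₁.trans (step₂.trans_eq step₃)).trans_eq ?_
    rw [hB, ramp_apply, ← hc, Nat.factorial_succ]
    push_cast
    field_simp
    ring

/-- A Volterra operator with bounded coefficient is quasi-nilpotent, since its `n`-th power decays
like `Cⁿ / n!`; hence the integral equation is uniquely solvable. -/
theorem isUnit_one_sub_volterra {ℓ M : ℝ} (hℓ : 0 ≤ ℓ) {q : Lp ℝ 2 (slab ℓ)}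
    (hM : ∀ᵐ t ∂slab ℓ, |q t| ≤ M) :
    IsUnit (1 - volterra ℓ q : (ℝ →ᵇ ℝ) →L[ℝ] (ℝ →ᵇ ℝ)) := by
  wlog hM₀ : 0 ≤ M generalizing M
  · exact this (M := |M|) (hM.mono fun t ht => ht.trans (le_abs_self M)) (abs_nonneg M)
  set C := 2 * ℓ * M * (2 * ℓ) with hC
  have hC₀ : 0 ≤ C := by positivity
  have hbound : ∀ n : ℕ, ‖volterra ℓ q ^ n‖ ≤ C ^ n / n.factorial := fun n => by
    refine ContinuousLinearMap.opNorm_le_bound _ (by positivity) fun y => ?_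
    refine (BoundedContinuousFunction.norm_le (by positivity)).2 fun x => ?_
    refine (abs_volterra_pow_apply_le hℓ hM₀ hM y n x).trans ?_
    have h₁ : 0 ≤ ramp ℓ x := by
      rw [ramp_apply]; linarith [neg_le_clamp ℓ x]
    have h₂ : ramp ℓ x ≤ 2 * ℓ := by
      rw [ramp_apply]; linarith [clamp_le hℓ x]
    calc ‖y‖ * (2 * ℓ * M) ^ n * (ramp ℓ x ^ n / n.factorial)
        ≤ ‖y‖ * (2 * ℓ * M) ^ n * ((2 * ℓ) ^ n / n.factorial) := by gcongr
      _ = _ := by rw [hC, mul_pow _ (2 * ℓ)]; ring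
  obtain ⟨n, hn⟩ : ∃ n : ℕ, ‖volterra ℓ q ^ n‖ < 1 := by
    have h := (FloorSemiring.tendsto_pow_div_factorial_atTop C).eventually_lt_const
      (zero_lt_one)
    obtain ⟨n, hn⟩ := h.exists
    exact ⟨n, (hbound n).trans_lt hn⟩
  have h₁ : IsUnit (1 - volterra ℓ q ^ n) := (Units.oneSub _ hn).isUnit
  have hcomm := mul_neg_geom_sum (volterra ℓ q) n
  have hcomm' := geom_sum_mul_neg (volterra ℓ q) n
  have : Commute (1 - volterra ℓ q) (∑ i ∈ Finset.range n, volterra ℓ q ^ i) :=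
    hcomm.trans hcomm'.symm
  exact (this.isUnit_mul_iff.1 (hcomm ▸ h₁)).1

/-! ### The Wronskian identity -/

theorem integral_kern_end {ℓ : ℝ} (hℓ : 0 ≤ ℓ) {f : ℝ → ℝ} (hf : Integrable f (slab ℓ)) :
    ∫ t, kern ℓ ℓ t * f t ∂slab ℓ
      = 2 * ℓ * (∫ t, f t ∂slab ℓ) - ∫ t, f t * ramp ℓ t ∂slab ℓ := by
  rw [← integral_const_mul, ← integral_sub (hf.const_mul _) (integrable_mul_bcf hf _)]
  refine integral_congr_ae ?_
  filter_upwards [ae_slab_mem ℓ] with t ht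
  rw [kern_apply, ramp_apply, clamp_of_mem (by linarith) le_rfl, clamp_of_mem ht.1.le ht.2,
    max_eq_left (by linarith [ht.2])]
  ring

/-- The antisymmetric part of the kernel `(x - t)⁺` is `x - t`, which separates. -/
theorem integral_kern_antisymm {ℓ : ℝ} {f g : ℝ → ℝ} (hf : Integrable f (slab ℓ))
    (hg : Integrable g (slab ℓ)) :
    (∫ x, f x * (∫ t, kern ℓ x t * g t ∂slab ℓ) ∂slab ℓ)
        - ∫ x, g x * (∫ t, kern ℓ x t * f t ∂slab ℓ) ∂slab ℓ
      = (∫ x, f x * ramp ℓ x ∂slab ℓ) * (∫ x, g x ∂slab ℓ)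
        - (∫ x, f x ∂slab ℓ) * ∫ x, g x * ramp ℓ x ∂slab ℓ := by
  have hk : Continuous fun p : ℝ × ℝ => kern ℓ p.1 p.2 := by
    simp only [kern_apply]
    fun_prop
  have hkb : ∀ p : ℝ × ℝ, ‖kern ℓ p.1 p.2‖ ≤ 2 * |ℓ| := fun p =>
    ((kern ℓ p.1).norm_coe_le_norm p.2).trans (norm_kern_le ℓ p.1)
  have hint : ∀ {φ ψ : ℝ → ℝ}, Integrable φ (slab ℓ) → Integrable ψ (slab ℓ) →
      Integrable (fun p : ℝ × ℝ => φ p.1 * ψ p.2 * kern ℓ p.1 p.2)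
        ((slab ℓ).prod (slab ℓ)) := fun hφ hψ =>
    (hφ.mul_prod hψ).mul_bdd (c := 2 * |ℓ|) hk.aestronglyMeasurable
      (Eventually.of_forall hkb)
  have e : ∀ {φ ψ : ℝ → ℝ}, Integrable φ (slab ℓ) → Integrable ψ (slab ℓ) →
      ∫ x, φ x * (∫ t, kern ℓ x t * ψ t ∂slab ℓ) ∂slab ℓ
        = ∫ p, φ p.1 * ψ p.2 * kern ℓ p.1 p.2 ∂(slab ℓ).prod (slab ℓ) := by
    intro φ ψ hφ hψ
    rw [integral_prod _ (hint hφ hψ)]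
    refine integral_congr_ae (Eventually.of_forall fun x => ?_)
    simp only
    rw [← integral_const_mul]
    refine integral_congr_ae (Eventually.of_forall fun t => ?_)
    simp only
    ring
  have e₂ : ∫ p, g p.1 * f p.2 * kern ℓ p.1 p.2 ∂(slab ℓ).prod (slab ℓ)
      = ∫ p, f p.1 * g p.2 * kern ℓ p.2 p.1 ∂(slab ℓ).prod (slab ℓ) := by
    rw [← integral_prod_swap]
    refine integral_congr_ae (Eventually.of_forall fun p => ?_)
    simp only [Prod.fst_swap, Prod.snd_swap]
    ring
  have hsw : Integrable (fun p : ℝ × ℝ => f p.1 * g p.2 * kern ℓ p.2 p.1)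
        ((slab ℓ).prod (slab ℓ)) := by
    refine (hint hg hf).swap.congr (Eventually.of_forall fun p => ?_)
    simp only [Function.comp, Prod.fst_swap, Prod.snd_swap]
    ring
  rw [e hf hg, e hg hf, e₂, ← integral_sub (hint hf hg) hsw, ← integral_prod_mul,
    ← integral_prod_mul,
    ← integral_sub ((integrable_mul_bcf hf _).mul_prod hg)
      (hf.mul_prod (integrable_mul_bcf hg _))]
  refine integral_congr_ae (Eventually.of_forall fun p => ?_)
  simp only [kern_apply, ramp_apply]
  have : max (clamp ℓ p.1 - clamp ℓ p.2) 0 - max (clamp ℓ p.2 - clamp ℓ p.1) 0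
      = clamp ℓ p.1 - clamp ℓ p.2 := by grind
  linear_combination (f p.1 * g p.2) * this

/-- `y` solves `y'' = f` on `[-ℓ, ℓ]` with `y(-ℓ) = a` and `y'(-ℓ) = b`. -/
structure Primitive (ℓ a b : ℝ) (f : ℝ → ℝ) (y : ℝ →ᵇ ℝ) : Prop where
  integrable : Integrable f (slab ℓ)
  eq : ∀ x, y x = a + b * ramp ℓ x + ∫ t, kern ℓ x t * f t ∂slab ℓ

/-- The Wronskian identity `[y₁' y₂ - y₁ y₂']_{-ℓ}^{ℓ} = ∫ (y₁'' y₂ - y₂'' y₁)`. -/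
theorem Primitive.wronskian {ℓ a₁ b₁ a₂ b₂ : ℝ} (hℓ : 0 ≤ ℓ) {f₁ f₂ : ℝ → ℝ}
    {y₁ y₂ : ℝ →ᵇ ℝ} (h₁ : Primitive ℓ a₁ b₁ f₁ y₁) (h₂ : Primitive ℓ a₂ b₂ f₂ y₂) :
    (b₁ + ∫ t, f₁ t ∂slab ℓ) * y₂ ℓ - y₁ ℓ * (b₂ + ∫ t, f₂ t ∂slab ℓ) - (b₁ * a₂ - a₁ * b₂)
      = (∫ t, f₁ t * y₂ t ∂slab ℓ) - ∫ t, f₂ t * y₁ t ∂slab ℓ := by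
  have hramp : ramp ℓ ℓ = 2 * ℓ := by
    rw [ramp_apply, clamp_of_mem (by linarith) le_rfl]; ring
  have expand : ∀ {a b : ℝ} {f g : ℝ → ℝ} {y : ℝ →ᵇ ℝ}, Integrable g (slab ℓ) →
      Primitive ℓ a b f y → ∫ t, g t * y t ∂slab ℓ = a * (∫ t, g t ∂slab ℓ)
        + b * (∫ t, g t * ramp ℓ t ∂slab ℓ)
        + ∫ x, g x * (∫ t, kern ℓ x t * f t ∂slab ℓ) ∂slab ℓ := by
    intro a b f g y hg hy
    have e : ∀ x, g x * (∫ t, kern ℓ x t * f t ∂slab ℓ)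
        = g x * y x - (a * g x + b * (g x * ramp ℓ x)) := fun x => by
      rw [hy.eq x]; ring
    have hi : Integrable (fun x => a * g x + b * (g x * ramp ℓ x)) (slab ℓ) :=
      (hg.const_mul a).add ((integrable_mul_bcf hg _).const_mul b)
    simp only [e]
    rw [integral_sub (integrable_mul_bcf hg _) hi,
      integral_add (hg.const_mul a) ((integrable_mul_bcf hg _).const_mul b),
      integral_const_mul, integral_const_mul]
    ring
  rw [expand h₁.integrable h₂, expand h₂.integrable h₁, h₁.eq ℓ, h₂.eq ℓ,
    integral_kern_end hℓ h₁.integrable, integral_kern_end hℓ h₂.integrable, hramp]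
  linear_combination -integral_kern_antisymm h₁.integrable h₂.integrable

/-! ### Functions with locally absolutely continuous derivative -/

theorem LocallyAC.continuous {E : Type*} [NormedAddCommGroup E] {f : ℝ → E}
    (hf : LocallyAC f) : Continuous f := by
  refine continuous_iff_continuousAt.2 fun x => ?_
  refine (hf (x - 1) (x + 1)).continuousOn.continuousAt ?_
  rw [Set.uIcc_of_le (by linarith)]
  exact Icc_mem_nhds (by linarith) (by linarith)

/-- A property that holds almost everywhere on each bounded interval holds almost everywhere. -/
theorem ae_of_forall_mem_uIcc {p : ℝ → Prop}
    (h : ∀ a b : ℝ, ∀ᵐ x : ℝ, x ∈ Set.uIcc a b → p x) : ∀ᵐ x : ℝ, p x := by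
  have h' : ∀ᵐ x : ℝ, ∀ n : ℕ, x ∈ Set.uIcc (-(n : ℝ)) n → p x := ae_all_iff.2 fun n => h _ _
  filter_upwards [h'] with x hx
  obtain ⟨n, hn⟩ := exists_nat_ge |x|
  refine hx n ?_
  rw [Set.uIcc_of_le (by linarith [n.cast_nonneg (α := ℝ)])]
  exact abs_le.1 hn

theorem LocallyAC.ae_differentiableAt {E : Type*} [NormedAddCommGroup E] [NormedSpace ℝ E]
    [FiniteDimensional ℝ E] {f : ℝ → E} (hf : LocallyAC f) :
    ∀ᵐ x : ℝ, DifferentiableAt ℝ f x :=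
  ae_of_forall_mem_uIcc fun a b => (hf a b).boundedVariationOn.ae_differentiableAt_of_mem_uIcc

theorem LocallyAC.clm_comp {E F : Type*} [NormedAddCommGroup E] [NormedSpace ℝ E]
    [NormedAddCommGroup F] [NormedSpace ℝ F] {f : ℝ → E} (hf : LocallyAC f) (T : E →L[ℝ] F) :
    LocallyAC (fun x => T (f x)) := by
  intro a b
  have h := hf a b
  unfold AbsolutelyContinuousOnInterval at h ⊢
  have h' := h.const_mul ‖T‖
  rw [mul_zero] at h'
  refine squeeze_zero (fun E => Finset.sum_nonneg fun i _ => dist_nonneg) (fun E => ?_) h'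
  rw [Finset.mul_sum]
  exact Finset.sum_le_sum fun i _ => T.lipschitz.dist_le_mul _ _

theorem LocallyAC.integral {f : ℝ → ℝ} (hf : ∀ a b, IntervalIntegrable f volume a b) (c : ℝ) :
    LocallyAC (fun x => ∫ t in c..x, f t) := by
  intro a b
  have h := (hf (min a (min b c)) (max a (max b c))).absolutelyContinuousOnInterval_intervalIntegral
    (c := c) (by rw [Set.uIcc_of_le (by simp)]; simp)
  refine h.mono ?_
  rw [Set.uIcc_of_le (a := min a (min b c)) (by simp)]
  exact Set.uIcc_subset_Icc (by simp) (by simp)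

theorem ae_hasDerivAt_integral {f : ℝ → ℝ} (hf : ∀ a b, IntervalIntegrable f volume a b)
    (c : ℝ) : ∀ᵐ x : ℝ, HasDerivAt (fun x => ∫ t in c..x, f t) (f x) x := by
  refine ae_of_forall_mem_uIcc fun a b => ?_
  have h := (hf (min a (min b c)) (max a (max b c))).ae_hasDerivAt_integral
  have hle : min a (min b c) ≤ max a (max b c) := by simp
  filter_upwards [h] with x hx hxab
  rw [Set.uIcc_of_le hle] at hx
  exact hx (Set.uIcc_subset_Icc (by simp) (by simp) hxab) c (by simp)

section Taylor

variable {y : ℝ → ℝ}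

theorem deriv_eq_add_integral (hac : LocallyAC (deriv y)) (a x : ℝ) :
    deriv y x = deriv y a + ∫ t in a..x, deriv (deriv y) t := by
  rw [(hac a x).integral_deriv_eq_sub]
  ring

theorem eq_add_integral_deriv (hd : Differentiable ℝ y) (hac : LocallyAC (deriv y)) (a x : ℝ) :
    y x = y a + ∫ t in a..x, deriv y t := by
  rw [intervalIntegral.integral_deriv_eq_sub (fun t _ => hd t)
    (hac.continuous.intervalIntegrable _ _)]
  ring

/-- Taylor's formula of order two with integral remainder. -/
theorem taylor_two (hd : Differentiable ℝ y) (hac : LocallyAC (deriv y)) (a x : ℝ) :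
    y x = y a + deriv y a * (x - a) + ∫ t in a..x, (x - t) * deriv (deriv y) t := by
  have hl : AbsolutelyContinuousOnInterval (fun t : ℝ => x - t) a x :=
    (ContDiff.contDiffOn (by fun_prop)).absolutelyContinuousOnInterval
  rw [hl.integral_mul_deriv_eq_deriv_mul (hac a x), eq_add_integral_deriv hd hac a x]
  have : ∀ t : ℝ, deriv (fun t : ℝ => x - t) t = -1 := fun t => by
    rw [deriv_const_sub]; simp
  simp only [this, neg_mul, one_mul, intervalIntegral.integral_neg]
  ring

/-- The restriction of a solution to `[-ℓ, ℓ]` in integral form. -/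
theorem primitive_restr (hd : Differentiable ℝ y) (hac : LocallyAC (deriv y)) {ℓ : ℝ}
    (hℓ : 0 ≤ ℓ) {f : ℝ → ℝ} (hf : deriv (deriv y) =ᵐ[slab ℓ] f) :
    Primitive ℓ (y (-ℓ)) (deriv y (-ℓ)) f (restr ℓ y hd.continuous) := by
  refine ⟨?_, fun x => ?_⟩
  · refine Integrable.congr ?_ hf
    exact (intervalIntegrable_iff_integrableOn_Ioc_of_le (by linarith)).1
      (hac (-ℓ) ℓ).intervalIntegrable_deriv
  · rw [restr_apply, taylor_two hd hac (-ℓ), ← kern_clamp ℓ x hℓ, ramp_apply,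
      ← integral_kern_mul (neg_le_clamp _ _) (clamp_le hℓ _), sub_neg_eq_add]
    congr 1
    refine integral_congr_ae ?_
    filter_upwards [hf] with t ht
    rw [ht]

theorem deriv_end_eq (hac : LocallyAC (deriv y)) {ℓ : ℝ}
    (hℓ : 0 ≤ ℓ) {f : ℝ → ℝ} (hf : deriv (deriv y) =ᵐ[slab ℓ] f) :
    deriv y ℓ = deriv y (-ℓ) + ∫ t, f t ∂slab ℓ := by
  rw [deriv_eq_add_integral hac (-ℓ) ℓ, ← integral_slab_eq_intervalIntegral hℓ,
    integral_congr_ae hf]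

/-- A function is affine where its second derivative vanishes. -/
theorem eq_affine_of_ae_deriv_deriv_eq_zero (hd : Differentiable ℝ y)
    (hac : LocallyAC (deriv y)) {a x : ℝ}
    (h : ∀ᵐ t : ℝ, t ∈ Set.uIoc a x → deriv (deriv y) t = 0) :
    y x = y a + deriv y a * (x - a) := by
  rw [taylor_two hd hac a x, intervalIntegral.integral_congr_ae (g := fun _ => 0)]
  · simp
  · filter_upwards [h] with t ht hmem
    rw [ht hmem, mul_zero]

end Taylor

/-! ### Square integrable solutions on a half-line -/

/-- On an unbounded interval `S` where `y'' = s² y`, a solution that is square integrable together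
with its derivative is a multiple of `exp (s x)`, provided that `exp (-s x)` does not decay on
`S`: the combination `y' - s y` is a multiple of `exp (-s x)`. -/
theorem deriv_eq_mul_of_memLp {y : ℝ → ℝ} (hd : Differentiable ℝ y) (hac : LocallyAC (deriv y))
    (hy : MemLp y 2 volume) (hy' : MemLp (deriv y) 2 volume) {S : Set ℝ} [S.OrdConnected]
    (hSm : MeasurableSet S) (hS : volume S = ⊤) {s : ℝ} (hs : ∀ x ∈ S, s * x ≤ 0)
    (heq : ∀ᵐ x : ℝ, x ∈ S → deriv (deriv y) x = s ^ 2 * y x) :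
    ∀ x ∈ S, deriv y x = s * y x := by
  set h : ℝ → ℝ := fun x => Real.exp (s * x) * (deriv y x - s * y x) with hh
  have hyac : LocallyAC y := by
    have : y = fun x => y 0 + ∫ t in (0 : ℝ)..x, deriv y t :=
      funext fun x => eq_add_integral_deriv hd hac 0 x
    intro a b
    have h₁ : AbsolutelyContinuousOnInterval (fun _ : ℝ => y 0) a b :=
      (ContDiff.contDiffOn (by fun_prop)).absolutelyContinuousOnInterval
    rw [this]
    exact h₁.add (LocallyAC.integral (fun a b => hac.continuous.intervalIntegrable a b) 0 a b)
  have hhac : LocallyAC h := fun a b => by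
    have h₁ : AbsolutelyContinuousOnInterval (fun x : ℝ => Real.exp (s * x)) a b :=
      (ContDiff.contDiffOn (by fun_prop)).absolutelyContinuousOnInterval
    exact h₁.fun_mul ((hac a b).sub ((hyac a b).const_mul s))
  have hder : ∀ᵐ x : ℝ, x ∈ S → HasDerivAt h 0 x := by
    filter_upwards [heq, hac.ae_differentiableAt] with x hx hx' hxS
    have h₁ : HasDerivAt (fun x : ℝ => Real.exp (s * x)) (Real.exp (s * x) * s) x := by
      simpa using ((hasDerivAt_id x).const_mul s).exp
    have h₂ := hx'.hasDerivAt
    rw [hx hxS] at h₂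
    have h₃ := h₁.mul (h₂.sub ((hd x).hasDerivAt.const_mul s))
    convert! h₃ using 1
    simp only [Pi.sub_apply]
    ring
  have hconst : ∀ a ∈ S, ∀ b ∈ S, h a = h b := fun a ha b hb => by
    obtain ⟨C, hC⟩ := (hhac a b).const_of_ae_hasDerivAt_zero (by
      filter_upwards [hder] with x hx hxm
      exact hx (Set.OrdConnected.uIcc_subset ‹_› ha hb hxm))
    rw [hC a Set.left_mem_uIcc, hC b Set.right_mem_uIcc]
  intro a ha
  by_contra hne
  have hC : h a ≠ 0 := mul_ne_zero (Real.exp_pos _).ne' (sub_ne_zero.2 hne)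
  have hg : MemLp (fun x => deriv y x - s * y x) 2 (volume.restrict S) :=
    (hy'.sub (hy.const_mul s)).restrict S
  have hcon : MemLp (fun _ : ℝ => h a) 2 (volume.restrict S) := by
    refine hg.mono aestronglyMeasurable_const ?_
    filter_upwards [ae_restrict_mem hSm] with x hx
    rw [hconst a ha x hx, hh]
    simp only [norm_mul, Real.norm_eq_abs, Real.abs_exp]
    exact mul_le_of_le_one_left (abs_nonneg _) (Real.exp_le_one_iff.2 (hs x hx))
  rw [memLp_const_iff (by norm_num) (by norm_num)] at hcon
  rcases hcon with h₀ | h₀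
  · exact hC h₀
  · rw [Measure.restrict_apply_univ, hS] at h₀
    exact lt_irrefl _ h₀

/-- A solution of `y' = s y` on an interval with a zero there vanishes identically there. -/
theorem eq_zero_of_deriv_eq_mul {y : ℝ → ℝ} (hd : Differentiable ℝ y) {S : Set ℝ}
    [S.OrdConnected] {s : ℝ} (h : ∀ x ∈ S, deriv y x = s * y x) {a : ℝ} (ha : a ∈ S)
    (hya : y a = 0) : ∀ x ∈ S, y x = 0 := by
  intro x hx
  have hder : ∀ t ∈ S, HasDerivAt (fun t => Real.exp (-s * t) * y t) 0 t := fun t ht => by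
    have h₁ : HasDerivAt (fun x : ℝ => Real.exp (-s * x)) (Real.exp (-s * t) * -s) t := by
      simpa using ((hasDerivAt_id t).const_mul (-s)).exp
    have h₂ := (hd t).hasDerivAt
    rw [h t ht] at h₂
    convert! h₁.mul h₂ using 1
    ring
  have hconv : Convex ℝ S := convex_iff_ordConnected.2 ‹S.OrdConnected›
  have hconst := hconv.norm_image_sub_le_of_norm_hasDerivWithin_le
    (fun t ht => (hder t ht).hasDerivWithinAt) (C := 0) (by simp) ha hx
  rw [zero_mul, norm_le_zero_iff, hya, mul_zero, sub_zero] at hconst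
  exact (mul_eq_zero.1 hconst).resolve_left (Real.exp_pos _).ne'

/-! ### Perturbation of the integral equation -/

/-- The constant function `1` on `[-ℓ, ℓ]`. -/
def oneLp (ℓ : ℝ) : Lp ℝ 2 (slab ℓ) := BoundedContinuousFunction.toLp 2 (slab ℓ) ℝ 1

theorem coeFn_oneLp (ℓ : ℝ) : ∀ᵐ t ∂slab ℓ, oneLp ℓ t = 1 := by
  filter_upwards [BoundedContinuousFunction.coeFn_toLp (p := 2) (μ := slab ℓ) ℝ (1 : ℝ →ᵇ ℝ)]
    with t ht
  rw [oneLp, ht]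
  rfl

theorem tendsto_clm_apply {α E F : Type*} [NormedAddCommGroup E] [NormedSpace ℝ E]
    [NormedAddCommGroup F] [NormedSpace ℝ F] {l : Filter α} {T : α → E →L[ℝ] F} {f : α → E}
    {T₀ : E →L[ℝ] F} {f₀ : E} (hT : Tendsto T l (𝓝 T₀)) (hf : Tendsto f l (𝓝 f₀)) :
    Tendsto (fun x => T x (f x)) l (𝓝 (T₀ f₀)) :=
  ((isBoundedBilinearMap_apply (𝕜 := ℝ)).continuous.tendsto (T₀, f₀)).comp (hT.prodMk_nhds hf)

theorem tendsto_eval {α : Type*} {l : Filter α} {f : α → ℝ →ᵇ ℝ} {f₀ : ℝ →ᵇ ℝ}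
    (hf : Tendsto f l (𝓝 f₀)) (x : ℝ) : Tendsto (fun a => f a x) l (𝓝 (f₀ x)) :=
  ((BoundedContinuousFunction.evalCLM ℝ x).continuous.tendsto f₀).comp hf

section Perturbation

variable {ℓ : ℝ} (q : Lp ℝ 2 (slab ℓ)) (v : ℝ → Lp ℝ 2 (slab ℓ))

/-- The potential `lam v_lam + κ²` on `[-ℓ, ℓ]` by which `q` is perturbed, at `p = (lam, κ)`. The
summand `κ²` moves the spectral parameter `-κ²` into the potential. -/
def perturbation (p : ℝ × ℝ) : Lp ℝ 2 (slab ℓ) := p.1 • v p.1 + p.2 ^ 2 • oneLp ℓ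

/-- The operator whose inverse solves the initial value problem at `-ℓ` for the perturbed
potential. -/
def volterraOp (p : ℝ × ℝ) : (ℝ →ᵇ ℝ) →L[ℝ] (ℝ →ᵇ ℝ) :=
  1 - volterra ℓ (q + perturbation v p)

/-- The solution on `[-ℓ, ℓ]` of the perturbed equation with `y(-ℓ) = 1` and `y'(-ℓ) = κ`, which
continues `exp (κ (x + ℓ))` from the left. The value is junk where `volterraOp` is not
invertible. -/
def leftSol (p : ℝ × ℝ) : ℝ →ᵇ ℝ :=
  Ring.inverse (volterraOp q v p) (1 + p.2 • ramp ℓ)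

/-- The coefficient of `κ` in `jostFun`. -/
def jostCoeff (u : ℝ →ᵇ ℝ) (p : ℝ × ℝ) : ℝ :=
  1 + u ℓ * leftSol q v p ℓ + p.2 * pairing ℓ (oneLp ℓ) (leftSol q v p * u)

/-- The coefficient of `lam` in `jostFun`. -/
def jostRest (u : ℝ →ᵇ ℝ) (p : ℝ × ℝ) : ℝ := pairing ℓ (v p.1) (leftSol q v p * u)

/-- A nonzero multiple of the Jost function, whose zeros `κ > 0` give the eigenvalues `-κ²`,
in the form that the Wronskian identity with the half-bound state `u` yields. -/
def jostFun (u : ℝ →ᵇ ℝ) (p : ℝ × ℝ) : ℝ :=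
  p.2 * jostCoeff q v u p + p.1 * jostRest q v u p

variable {q v}

theorem volterraOp_mul_inverse_apply {p : ℝ × ℝ} (hp : IsUnit (volterraOp q v p))
    (f : ℝ →ᵇ ℝ) : volterraOp q v p (Ring.inverse (volterraOp q v p) f) = f := by
  rw [← mul_apply_eq_comp, Ring.mul_inverse_cancel _ hp]
  rfl

theorem eq_inverse_apply {T : (ℝ →ᵇ ℝ) →L[ℝ] (ℝ →ᵇ ℝ)} (hT : IsUnit T) {f y : ℝ →ᵇ ℝ}
    (h : T y = f) : y = Ring.inverse T f := by
  rw [← h, ← mul_apply_eq_comp, Ring.inverse_mul_cancel _ hT]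
  rfl

theorem leftSol_eq {p : ℝ × ℝ} (hp : IsUnit (volterraOp q v p)) :
    leftSol q v p = 1 + p.2 • ramp ℓ + volterra ℓ (q + perturbation v p) (leftSol q v p) := by
  have h := volterraOp_mul_inverse_apply hp (1 + p.2 • ramp ℓ)
  change leftSol q v p - volterra ℓ (q + perturbation v p) (leftSol q v p) = _ at h
  rw [← h]
  abel

theorem primitive_of_eq {y : ℝ →ᵇ ℝ} {a b : ℝ} {r : Lp ℝ 2 (slab ℓ)}
    (h : y = a • 1 + b • ramp ℓ + volterra ℓ r y) :
    Primitive ℓ a b (fun t => r t * y t) y := by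
  refine ⟨integrable_Lp_mul r y, fun x => ?_⟩
  have hx := congrArg (fun g : ℝ →ᵇ ℝ => g x) h
  simp only [BoundedContinuousFunction.add_apply, BoundedContinuousFunction.smul_apply,
    BoundedContinuousFunction.coe_one, Pi.one_apply, smul_eq_mul, mul_one] at hx
  rw [hx, volterra_apply_eq_integral]
  congr 1
  refine integral_congr_ae (Eventually.of_forall fun t => ?_)
  simp only
  ring

theorem eq_of_primitive {y : ℝ →ᵇ ℝ} {a b : ℝ} {r : Lp ℝ 2 (slab ℓ)} {f : ℝ → ℝ}
    (hf : f =ᵐ[slab ℓ] fun t => r t * y t) (h : Primitive ℓ a b f y) :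
    y = a • 1 + b • ramp ℓ + volterra ℓ r y := by
  ext x
  simp only [BoundedContinuousFunction.add_apply, BoundedContinuousFunction.smul_apply,
    BoundedContinuousFunction.coe_one, Pi.one_apply, smul_eq_mul, mul_one]
  rw [h.eq x, volterra_apply_eq_integral]
  congr 1
  refine integral_congr_ae ?_
  filter_upwards [hf] with t ht
  rw [ht]
  ring

/-- At the right end point, `θ (y' + κ y)` for the solution `y` issued from the left is the Jost
function. -/
theorem jostFun_eq (hℓ : 0 ≤ ℓ) {u : ℝ →ᵇ ℝ}
    (hu : Primitive ℓ 1 0 (fun t => q t * u t) u) (hu' : ∫ t, q t * u t ∂slab ℓ = 0)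
    {p : ℝ × ℝ} (hp : IsUnit (volterraOp q v p)) :
    jostFun q v u p = u ℓ * (p.2 + pairing ℓ (q + perturbation v p) (leftSol q v p)
      + p.2 * leftSol q v p ℓ) := by
  set y := leftSol q v p with hy
  have hyp : Primitive ℓ 1 p.2 (fun t => (q + perturbation v p) t * y t) y :=
    primitive_of_eq (by rw [one_smul]; exact leftSol_eq hp)
  have hW := hyp.wronskian hℓ hu
  have e₁ : ∫ t, ((q + perturbation v p) t * y t) * u t ∂slab ℓ
      = pairing ℓ (q + perturbation v p) (y * u) := by
    rw [pairing_apply]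
    refine integral_congr_ae (Eventually.of_forall fun t => ?_)
    simp [mul_assoc]
  have e₂ : ∫ t, (q t * u t) * y t ∂slab ℓ = pairing ℓ q (y * u) := by
    rw [pairing_apply]
    refine integral_congr_ae (Eventually.of_forall fun t => ?_)
    simp only [BoundedContinuousFunction.mul_apply]
    ring
  rw [e₁, e₂, hu', ← pairing_apply] at hW
  have e₃ : pairing ℓ (q + perturbation v p) (y * u) - pairing ℓ q (y * u)
      = p.1 * pairing ℓ (v p.1) (y * u) + p.2 ^ 2 * pairing ℓ (oneLp ℓ) (y * u) := by
    simp [perturbation]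
  rw [e₃] at hW
  rw [jostFun, jostCoeff, jostRest, ← hy]
  linear_combination -hW

/-- A nonzero value at the right end point, from the Wronskian with a second solution. -/
theorem end_ne_zero (hℓ : 0 ≤ ℓ) (hq : IsUnit (1 - volterra ℓ q)) {u : ℝ →ᵇ ℝ}
    (hu : Primitive ℓ 1 0 (fun t => q t * u t) u) (hu' : ∫ t, q t * u t ∂slab ℓ = 0) :
    u ℓ ≠ 0 := by
  set w := Ring.inverse (1 - volterra ℓ q) (ramp ℓ) with hw
  have hw' : w = (0 : ℝ) • 1 + (1 : ℝ) • ramp ℓ + volterra ℓ q w := by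
    have h : (1 - volterra ℓ q) w = ramp ℓ := by
      rw [hw, ← mul_apply_eq_comp, Ring.mul_inverse_cancel _ hq]
      rfl
    change w - volterra ℓ q w = ramp ℓ at h
    rw [zero_smul, one_smul, zero_add, ← h]
    abel
  have hW := (primitive_of_eq hw').wronskian hℓ hu
  have e : ∫ t, (q t * w t) * u t ∂slab ℓ = ∫ t, (q t * u t) * w t ∂slab ℓ :=
    integral_congr_ae (Eventually.of_forall fun t => by simp only; ring)
  rw [e, sub_self, hu'] at hW
  intro h
  rw [h] at hW
  norm_num at hW

theorem continuousAt_jostFun (u : ℝ →ᵇ ℝ) {lam κ : ℝ} (hT : IsUnit (volterraOp q v (lam, κ))) :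
    ContinuousAt (fun κ => jostFun q v u (lam, κ)) κ := by
  have hpert : Continuous fun κ : ℝ => perturbation v (lam, κ) := by
    have h : Continuous fun κ : ℝ => lam • v lam + κ ^ 2 • oneLp ℓ := by fun_prop
    exact h
  have hop : Continuous fun κ : ℝ => volterraOp q v (lam, κ) :=
    continuous_const.sub ((volterra ℓ).continuous.comp (continuous_const.add hpert))
  have hinv : ContinuousAt (fun κ : ℝ => Ring.inverse (volterraOp q v (lam, κ))) κ := by
    obtain ⟨T, hT⟩ := hT
    refine ContinuousAt.comp (g := Ring.inverse) ?_ hop.continuousAt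
    rw [← hT]
    exact NormedRing.inverse_continuousAt T
  have hfun : Continuous fun κ : ℝ => (1 : ℝ →ᵇ ℝ) + κ • ramp ℓ := by fun_prop
  have hY : Tendsto (fun κ : ℝ => leftSol q v (lam, κ)) (𝓝 κ) (𝓝 (leftSol q v (lam, κ))) :=
    tendsto_clm_apply hinv (hfun.tendsto κ)
  have hYℓ := tendsto_eval hY ℓ
  have hpair : ∀ r, Tendsto (fun κ : ℝ => pairing ℓ r (leftSol q v (lam, κ) * u)) (𝓝 κ)
      (𝓝 (pairing ℓ r (leftSol q v (lam, κ) * u))) :=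
    fun r => ((pairing ℓ r).continuous.tendsto _).comp (hY.mul_const u)
  have hcoeff : Tendsto (fun κ : ℝ => jostCoeff q v u (lam, κ)) (𝓝 κ)
      (𝓝 (jostCoeff q v u (lam, κ))) :=
    ((hYℓ.const_mul (u ℓ)).const_add 1).add (tendsto_id.mul (hpair (oneLp ℓ)))
  exact (tendsto_id.mul hcoeff).add ((hpair (v lam)).const_mul lam)

/-! ### Asymptotics of the Jost function -/

section Limits

variable {v₀ v₁ : Lp ℝ 2 (slab ℓ)} (hv : Tendsto v (𝓝[>] 0) (𝓝 v₀))
include hv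

theorem tendsto_volterraOp :
    Tendsto (volterraOp q v) (𝓝[>] 0 ×ˢ 𝓝 0) (𝓝 (1 - volterra ℓ q)) := by
  have h₁ : Tendsto (fun p : ℝ × ℝ => p.1) (𝓝[>] (0 : ℝ) ×ˢ 𝓝 (0 : ℝ)) (𝓝 0) :=
    tendsto_fst.mono_right nhdsWithin_le_nhds
  have h₂ : Tendsto (fun p : ℝ × ℝ => p.2) (𝓝[>] (0 : ℝ) ×ˢ 𝓝 (0 : ℝ)) (𝓝 0) := tendsto_snd
  have h₃ : Tendsto (fun p : ℝ × ℝ => perturbation v p) (𝓝[>] (0 : ℝ) ×ˢ 𝓝 (0 : ℝ)) (𝓝 0) := by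
    have h := (h₁.smul (hv.comp tendsto_fst)).add ((h₂.pow 2).smul_const (oneLp ℓ))
    simpa [perturbation] using h
  have h₄ := ((volterra ℓ).continuous.tendsto (q + 0)).comp (h₃.const_add q)
  have h₅ := h₄.const_sub (1 : (ℝ →ᵇ ℝ) →L[ℝ] (ℝ →ᵇ ℝ))
  rw [add_zero] at h₅
  exact h₅

variable (hq : IsUnit (1 - volterra ℓ q))
include hq

theorem eventually_isUnit_volterraOp :
    ∀ᶠ p in 𝓝[>] (0 : ℝ) ×ˢ 𝓝 (0 : ℝ), IsUnit (volterraOp q v p) :=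
  (tendsto_volterraOp hv).eventually (Units.isOpen.mem_nhds hq)

theorem tendsto_inverse_volterraOp :
    Tendsto (fun p => Ring.inverse (volterraOp q v p)) (𝓝[>] 0 ×ˢ 𝓝 0)
      (𝓝 (Ring.inverse (1 - volterra ℓ q))) := by
  obtain ⟨U, hU⟩ := hq
  rw [← hU]
  exact (NormedRing.inverse_continuousAt U).tendsto.comp (hU ▸ tendsto_volterraOp hv)

variable {u : ℝ →ᵇ ℝ} (hu : u = 1 + volterra ℓ q u)
include hu

theorem tendsto_leftSol : Tendsto (leftSol q v) (𝓝[>] 0 ×ˢ 𝓝 0) (𝓝 u) := by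
  have h₁ : u = Ring.inverse (1 - volterra ℓ q) 1 :=
    eq_inverse_apply hq (by change u - volterra ℓ q u = 1; nth_rw 1 [hu]; abel)
  have h₂ : Tendsto (fun p : ℝ × ℝ => (1 : ℝ →ᵇ ℝ) + p.2 • ramp ℓ)
      (𝓝[>] (0 : ℝ) ×ˢ 𝓝 (0 : ℝ)) (𝓝 1) := by
    have h := (tendsto_snd (f := 𝓝[>] (0 : ℝ)) (g := 𝓝 (0 : ℝ))).smul_const (ramp ℓ)
    simpa using h.const_add (1 : ℝ →ᵇ ℝ)
  rw [h₁]
  exact tendsto_clm_apply (tendsto_inverse_volterraOp hv hq) h₂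

theorem tendsto_jostRest :
    Tendsto (jostRest q v u) (𝓝[>] 0 ×ˢ 𝓝 0) (𝓝 (pairing ℓ v₀ (u * u))) := by
  have h₁ := (((pairing ℓ).continuous.tendsto v₀).comp hv).comp
    (tendsto_fst (f := 𝓝[>] (0 : ℝ)) (g := 𝓝 (0 : ℝ)))
  exact tendsto_clm_apply h₁ ((tendsto_leftSol hv hq hu).mul_const u)

theorem tendsto_jostCoeff :
    Tendsto (jostCoeff q v u) (𝓝[>] 0 ×ˢ 𝓝 0) (𝓝 (1 + u ℓ ^ 2)) := by
  have hY := tendsto_leftSol hv hq hu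
  have h₁ : Tendsto (fun p => leftSol q v p ℓ) (𝓝[>] 0 ×ˢ 𝓝 0) (𝓝 (u ℓ)) :=
    tendsto_eval hY ℓ
  have h₂ := ((pairing ℓ (oneLp ℓ)).continuous.tendsto (u * u)).comp (hY.mul_const u)
  have h₃ := (h₁.const_mul (u ℓ)).const_add 1
  have h₄ := h₃.add ((tendsto_snd (f := 𝓝[>] (0 : ℝ)) (g := 𝓝 (0 : ℝ))).mul h₂)
  convert! h₄ using 2
  ring

/-- Existence of small positive zeros: at `κ = c lam` the Jost function is
`lam (c (1 + θ²) + ∫ V u² + o(1))`, which changes sign between `c = m / 2` and `c = 2 m`, where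
`m = -∫ V u² / (1 + θ²) > 0`. -/
theorem exists_jostFun_eq_zero (hneg : pairing ℓ v₀ (u * u) < 0) :
    ∃ M : ℝ, ∀ᶠ lam in 𝓝[>] (0 : ℝ), ∃ κ, 0 < κ ∧ κ ≤ M * lam ∧
      IsUnit (volterraOp q v (lam, κ)) ∧ jostFun q v u (lam, κ) = 0 := by
  set a₀ := 1 + u ℓ ^ 2 with ha₀
  have ha₀' : 0 < a₀ := by positivity
  set m := -pairing ℓ v₀ (u * u) / a₀ with hm
  have hm₀ : 0 < m := div_pos (by linarith) ha₀'
  have hma : m * a₀ = -pairing ℓ v₀ (u * u) := by rw [hm]; field_simp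
  have hid : Tendsto (fun lam : ℝ => lam) (𝓝[>] 0) (𝓝 0) := tendsto_id.mono_left nhdsWithin_le_nhds
  have hray : ∀ c : ℝ, Tendsto (fun lam : ℝ => (lam, c * lam)) (𝓝[>] 0) (𝓝[>] 0 ×ˢ 𝓝 0) :=
    fun c => tendsto_id.prodMk (by simpa using hid.const_mul c)
  have hval : ∀ c : ℝ, Tendsto (fun lam : ℝ => c * jostCoeff q v u (lam, c * lam)
      + jostRest q v u (lam, c * lam)) (𝓝[>] 0) (𝓝 (c * a₀ + pairing ℓ v₀ (u * u))) :=
    fun c => (((tendsto_jostCoeff hv hq hu).comp (hray c)).const_mul c).add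
      ((tendsto_jostRest hv hq hu).comp (hray c))
  have hlow := (hval (m / 2)).eventually_lt_const (u := 0) (by nlinarith)
  have hhigh := (hval (2 * m)).eventually_const_lt (u := 0) (by nlinarith)
  obtain ⟨P, hP, Q, hQ, hPQ⟩ := eventually_prod_iff.1 (eventually_isUnit_volterraOp hv hq)
  obtain ⟨ε, hε, hball⟩ := Metric.eventually_nhds_iff.1 hQ
  have hsmall : ∀ᶠ lam in 𝓝[>] (0 : ℝ), 2 * m * lam < ε := by
    have h := hid.const_mul (2 * m)
    rw [mul_zero] at h
    exact h.eventually_lt_const hε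
  refine ⟨2 * m, ?_⟩
  filter_upwards [hlow, hhigh, hP, hsmall, self_mem_nhdsWithin] with lam h₁ h₂ h₃ h₄ h₅
  have hlam : 0 < lam := h₅
  have hunit : ∀ κ ∈ Set.Icc (m / 2 * lam) (2 * m * lam), IsUnit (volterraOp q v (lam, κ)) := by
    intro κ hκ
    refine hPQ h₃ (hball ?_)
    have : 0 < m / 2 * lam := by positivity
    rw [Real.dist_eq, sub_zero, abs_of_pos (this.trans_le hκ.1)]
    exact hκ.2.trans_lt h₄
  have hcont : ContinuousOn (fun κ => jostFun q v u (lam, κ))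
      (Set.Icc (m / 2 * lam) (2 * m * lam)) := fun κ hκ =>
    (continuousAt_jostFun u (hunit κ hκ)).continuousWithinAt
  have hle : m / 2 * lam ≤ 2 * m * lam := by nlinarith
  have hmem : (0 : ℝ) ∈ Set.Icc (jostFun q v u (lam, m / 2 * lam))
      (jostFun q v u (lam, 2 * m * lam)) := by
    constructor
    · have : jostFun q v u (lam, m / 2 * lam) = lam * (m / 2 * jostCoeff q v u (lam, m / 2 * lam)
          + jostRest q v u (lam, m / 2 * lam)) := by rw [jostFun]; ring
      rw [this]
      exact mul_nonpos_of_nonneg_of_nonpos hlam.le h₁.le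
    · have : jostFun q v u (lam, 2 * m * lam) = lam * (2 * m * jostCoeff q v u (lam, 2 * m * lam)
          + jostRest q v u (lam, 2 * m * lam)) := by rw [jostFun]; ring
      rw [this]
      exact mul_nonneg hlam.le h₂.le
  obtain ⟨κ, hκ, hz⟩ := intermediate_value_Icc hle hcont hmem
  exact ⟨κ, lt_of_lt_of_le (by positivity) hκ.1, hκ.2, hunit κ hκ, hz⟩

variable {κ : ℝ → ℝ} (hκ : Tendsto κ (𝓝[>] 0) (𝓝 0))
  (hz : ∀ᶠ lam in 𝓝[>] (0 : ℝ), jostFun q v u (lam, κ lam) = 0)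
include hκ hz

/-- The first order of a small zero of the Jost function. -/
theorem tendsto_zero_div :
    Tendsto (fun lam => κ lam / lam) (𝓝[>] 0)
      (𝓝 (-pairing ℓ v₀ (u * u) / (1 + u ℓ ^ 2))) := by
  have hp : Tendsto (fun lam => (lam, κ lam)) (𝓝[>] 0) (𝓝[>] (0 : ℝ) ×ˢ 𝓝 (0 : ℝ)) :=
    tendsto_id.prodMk hκ
  have ha := (tendsto_jostCoeff hv hq hu).comp hp
  have hb := (tendsto_jostRest hv hq hu).comp hp
  have ha₀ : (1 + u ℓ ^ 2) ≠ 0 := by positivity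
  refine (hb.neg.div ha ha₀).congr' ?_
  filter_upwards [hz, ha.eventually_ne ha₀, self_mem_nhdsWithin] with lam h₁ h₂ h₃
  have hlam : lam ≠ 0 := ne_of_gt h₃
  simp only [Function.comp, Pi.div_apply] at h₂ ⊢
  rw [jostFun] at h₁
  simp only at h₁
  rw [div_eq_div_iff h₂ hlam]
  linear_combination -h₁

/-- The second order of a small zero of the Jost function, in terms of the derivative
`m w + z` of the solution `leftSol` along the zero. -/
theorem tendsto_zero_second (hv₁ : Tendsto (fun lam : ℝ => lam⁻¹ • (v lam - v₀)) (𝓝[>] 0) (𝓝 v₁))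
    {w z : ℝ →ᵇ ℝ} (hw : w = ramp ℓ + volterra ℓ q w)
    (hzz : z = volterra ℓ v₀ u + volterra ℓ q z) {m : ℝ}
    (hm : m = -pairing ℓ v₀ (u * u) / (1 + u ℓ ^ 2)) :
    Tendsto (fun lam => (κ lam / lam - m) / lam) (𝓝[>] 0)
      (𝓝 (-(m * (u ℓ * (m * w ℓ + z ℓ) + m * pairing ℓ (oneLp ℓ) (u * u))
        + (pairing ℓ v₀ ((m • w + z) * u) + pairing ℓ v₁ (u * u))) / (1 + u ℓ ^ 2))) := by
  have hp : Tendsto (fun lam => (lam, κ lam)) (𝓝[>] 0) (𝓝[>] (0 : ℝ) ×ˢ 𝓝 (0 : ℝ)) :=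
    tendsto_id.prodMk hκ
  have hk := tendsto_zero_div hv hq hu hκ hz
  rw [← hm] at hk
  have ha₀ : (1 + u ℓ ^ 2) ≠ 0 := by positivity
  have hma : m * (1 + u ℓ ^ 2) = -pairing ℓ v₀ (u * u) := by rw [hm]; field_simp
  have hYt : Tendsto (fun lam => leftSol q v (lam, κ lam)) (𝓝[>] 0) (𝓝 u) :=
    (tendsto_leftSol hv hq hu).comp hp
  have hpos : ∀ᶠ lam in 𝓝[>] (0 : ℝ), lam ≠ 0 :=
    eventually_mem_of_tendsto_nhdsWithin (s := Set.Ioi 0) tendsto_id |>.mono fun _ h => ne_of_gt h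
  -- The difference quotient of the solutions.
  set R := Ring.inverse (1 - volterra ℓ q) with hR
  have hη : Tendsto (fun lam : ℝ => lam⁻¹ • (leftSol q v (lam, κ lam) - u)) (𝓝[>] 0)
      (𝓝 (m • w + z)) := by
    have hw' : w = R (ramp ℓ) := eq_inverse_apply hq (by
      change w - volterra ℓ q w = _; nth_rw 1 [hw]; abel)
    have hz' : z = R (volterra ℓ v₀ u) := eq_inverse_apply hq (by
      change z - volterra ℓ q z = _; nth_rw 1 [hzz]; abel)
    have h₁ : Tendsto (fun lam : ℝ => v lam + ((κ lam / lam) * κ lam) • oneLp ℓ) (𝓝[>] 0)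
        (𝓝 v₀) := by
      have h := hv.add ((hk.mul hκ).smul_const (oneLp ℓ))
      simpa using h
    have h₂ := tendsto_clm_apply (((volterra ℓ).continuous.tendsto v₀).comp h₁) hYt
    have h₃ := (hk.smul_const (ramp ℓ)).add h₂
    have h₄ := (R.continuous.tendsto _).comp h₃
    have e : R (m • ramp ℓ + volterra ℓ v₀ u) = m • w + z := by
      rw [map_add, map_smul, ← hw', ← hz']
    rw [e] at h₄
    refine h₄.congr' ?_
    filter_upwards [hp.eventually (eventually_isUnit_volterraOp hv hq), hpos] with lam h₅ h₆
    symm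
    refine eq_inverse_apply hq ?_
    have hY := leftSol_eq h₅
    set Y := leftSol q v (lam, κ lam) with hYdef
    change lam⁻¹ • (Y - u) - volterra ℓ q (lam⁻¹ • (Y - u)) = _
    have e₁ : Y - u - volterra ℓ q (Y - u)
        = κ lam • ramp ℓ + volterra ℓ (perturbation v (lam, κ lam)) Y := by
      rw [map_sub]
      rw [map_add, _root_.add_apply] at hY
      nth_rw 1 [hY, hu]
      simp only
      abel
    rw [map_smul, ← smul_sub, e₁, smul_add, smul_smul, ← _root_.smul_apply,
      ← map_smul, perturbation, smul_add, smul_smul, smul_smul, inv_mul_cancel₀ h₆, one_smul]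
    simp only [Function.comp]
    congr 2
    · rw [div_eq_inv_mul]
    · congr 3
      ring
  have hηℓ : Tendsto (fun lam : ℝ => lam⁻¹ * (leftSol q v (lam, κ lam) ℓ - u ℓ)) (𝓝[>] 0)
      (𝓝 (m * w ℓ + z ℓ)) :=
    by
    simpa using tendsto_eval hη ℓ
  have hA : Tendsto (fun lam => (jostCoeff q v u (lam, κ lam) - (1 + u ℓ ^ 2)) / lam) (𝓝[>] 0)
      (𝓝 (u ℓ * (m * w ℓ + z ℓ) + m * pairing ℓ (oneLp ℓ) (u * u))) := by
    have h₁ := ((pairing ℓ (oneLp ℓ)).continuous.tendsto (u * u)).comp (hYt.mul_const u)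
    refine ((hηℓ.const_mul (u ℓ)).add (hk.mul h₁)).congr' ?_
    filter_upwards [hpos] with lam hlam
    simp only [jostCoeff, Function.comp]
    field_simp
    ring
  have hB : Tendsto (fun lam => (jostRest q v u (lam, κ lam) - pairing ℓ v₀ (u * u)) / lam)
      (𝓝[>] 0) (𝓝 (pairing ℓ v₀ ((m • w + z) * u) + pairing ℓ v₁ (u * u))) := by
    have h₁ := tendsto_clm_apply (((pairing ℓ).continuous.tendsto v₁).comp hv₁) (hYt.mul_const u)
    have h₂ := ((pairing ℓ v₀).continuous.tendsto _).comp (hη.mul_const u)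
    refine (h₂.add h₁).congr' ?_
    filter_upwards [hpos] with lam hlam
    simp only [jostRest, Function.comp, smul_mul_assoc, map_smul, sub_mul, map_sub,
      _root_.smul_apply, _root_.sub_apply, smul_eq_mul]
    field_simp
    ring
  refine (((hk.mul hA).add hB).neg.div_const (1 + u ℓ ^ 2)).congr' ?_
  filter_upwards [hz, hpos] with lam h₁ h₂
  rw [jostFun] at h₁
  simp only at h₁
  simp only [div_eq_iff ha₀]
  field_simp
  have : m + u ℓ ^ 2 * m = -pairing ℓ v₀ (u * u) := by linear_combination hma
  linear_combination -h₁ + lam * this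

end Limits

end Perturbation

/-! ### From eigenvalues to zeros of the Jost function -/

theorem ae_mem_Iic_of_essSupportedIn {f : ℝ → ℝ} {ℓ : ℝ} (h : EssSupportedIn f ℓ) :
    ∀ᵐ x : ℝ, x ∈ Set.Iic (-ℓ) → f x = 0 := by
  filter_upwards [h, Measure.ae_ne volume (-ℓ)] with x hx hne hm
  have : x < -ℓ := lt_of_le_of_ne hm hne
  exact hx (lt_of_lt_of_le (by linarith) (neg_le_abs x))

theorem ae_mem_Ici_of_essSupportedIn {f : ℝ → ℝ} {ℓ : ℝ} (h : EssSupportedIn f ℓ) :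
    ∀ᵐ x : ℝ, x ∈ Set.Ici ℓ → f x = 0 := by
  filter_upwards [h, Measure.ae_ne volume ℓ] with x hx hne hm
  exact hx ((lt_of_le_of_ne hm hne.symm).trans_le (le_abs_self x))

/-- A real eigenvalue has a real eigenfunction. -/
theorem IsSchrodingerEigenvalue.exists_real {Q : ℝ → ℝ} {e : ℝ}
    (h : IsSchrodingerEigenvalue Q e) :
    ∃ y : ℝ → ℝ, Differentiable ℝ y ∧ LocallyAC (deriv y) ∧ MemLp y 2 volume ∧
      MemLp (deriv y) 2 volume ∧ (∃ x, y x ≠ 0) ∧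
      ∀ᵐ x : ℝ, deriv (deriv y) x = (Q x - e) * y x := by
  obtain ⟨ψ, hψ, hne, heq⟩ := h
  obtain ⟨T, hT, x₀, hx₀⟩ : ∃ T : ℂ →L[ℝ] ℝ, (∀ (r : ℝ) (z : ℂ), T (r * z) = r * T z) ∧
      ∃ x, T (ψ x) ≠ 0 := by
    by_contra! hcon
    refine hne (Eventually.of_forall fun x => ?_)
    refine Complex.ext ?_ ?_
    · exact hcon Complex.reCLM (by simp) x
    · exact hcon Complex.imCLM (by simp) x
  have hd : ∀ {φ : ℝ → ℂ} {x : ℝ}, DifferentiableAt ℝ φ x →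
      HasDerivAt (fun x => T (φ x)) (T (deriv φ x)) x := fun hφ =>
    T.hasFDerivAt.comp_hasDerivAt _ hφ.hasDerivAt
  have hderiv : deriv (fun x => T (ψ x)) = fun x => T (deriv ψ x) :=
    funext fun x => (hd (hψ.differentiable x)).deriv
  refine ⟨fun x => T (ψ x), fun x => (hd (hψ.differentiable x)).differentiableAt, ?_,
    T.comp_memLp' hψ.memLp, ?_, ⟨x₀, hx₀⟩, ?_⟩
  · rw [hderiv]
    exact hψ.deriv_ac.clm_comp T
  · rw [hderiv]
    exact T.comp_memLp' hψ.memLp_deriv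
  · filter_upwards [heq, hψ.deriv_ac.ae_differentiableAt] with x hx hx'
    rw [hderiv, (hd hx').deriv]
    have : deriv (deriv ψ) x = ((Q x - e : ℝ) : ℂ) * ψ x := by
      push_cast
      linear_combination -hx
    rw [this, hT]

section Jost

variable {ℓ : ℝ} {q : Lp ℝ 2 (slab ℓ)} {v : ℝ → Lp ℝ 2 (slab ℓ)} {Q : ℝ → ℝ} {lam κ : ℝ}

theorem coeFn_add_perturbation (hQ : ∀ᵐ t ∂slab ℓ, (q + lam • v lam) t = Q t) :
    ∀ᵐ t ∂slab ℓ, (q + perturbation v (lam, κ)) t = Q t + κ ^ 2 := by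
  have e : q + perturbation v (lam, κ) = (q + lam • v lam) + κ ^ 2 • oneLp ℓ := by
    rw [perturbation, add_assoc]
  rw [e]
  filter_upwards [hQ, Lp.coeFn_add (q + lam • v lam) (κ ^ 2 • oneLp ℓ),
    Lp.coeFn_smul (κ ^ 2) (oneLp ℓ), coeFn_oneLp ℓ] with t h₁ h₂ h₃ h₄
  rw [h₂, Pi.add_apply, h₁, h₃, Pi.smul_apply, h₄, smul_eq_mul, mul_one]

/-- The restriction of a decaying eigenfunction to `[-ℓ, ℓ]` is a multiple of `leftSol`, and its
decay on the right makes the Jost function vanish. -/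
theorem jostFun_eq_zero_of_eigenvalue (hℓ : 0 ≤ ℓ) {u : ℝ →ᵇ ℝ}
    (hu : Primitive ℓ 1 0 (fun t => q t * u t) u) (hu' : ∫ t, q t * u t ∂slab ℓ = 0)
    (hp : IsUnit (volterraOp q v (lam, κ))) (hκ : 0 < κ)
    (hQ : ∀ᵐ t ∂slab ℓ, (q + lam • v lam) t = Q t) (hQs : EssSupportedIn Q ℓ)
    (he : IsSchrodingerEigenvalue Q (-κ ^ 2)) : jostFun q v u (lam, κ) = 0 := by
  obtain ⟨y, hd, hac, hy, hy', ⟨x₀, hx₀⟩, heq⟩ := he.exists_real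
  have hL : ∀ x ∈ Set.Iic (-ℓ), deriv y x = κ * y x := by
    refine deriv_eq_mul_of_memLp hd hac hy hy' measurableSet_Iic Real.volume_Iic
      (fun x hx => mul_nonpos_of_nonneg_of_nonpos hκ.le (le_trans hx (by linarith))) ?_
    filter_upwards [heq, ae_mem_Iic_of_essSupportedIn hQs] with x h₁ h₂ hx
    rw [h₁, h₂ hx]
    ring
  have hR : ∀ x ∈ Set.Ici ℓ, deriv y x = -κ * y x := by
    refine deriv_eq_mul_of_memLp hd hac hy hy' measurableSet_Ici Real.volume_Ici
      (fun x hx => mul_nonpos_of_nonpos_of_nonneg (by linarith) (hℓ.trans hx)) ?_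
    filter_upwards [heq, ae_mem_Ici_of_essSupportedIn hQs] with x h₁ h₂ hx
    rw [h₁, h₂ hx]
    ring
  set y₀ := restr ℓ y hd.continuous with hy₀
  set r := q + perturbation v (lam, κ) with hr
  have hf : deriv (deriv y) =ᵐ[slab ℓ] fun t => r t * y₀ t := by
    filter_upwards [ae_restrict_of_ae heq, coeFn_add_perturbation (κ := κ) hQ, ae_slab_clamp ℓ]
      with t h₁ h₂ h₃
    rw [h₁, hr, h₂, hy₀, restr_apply, h₃]
    ring
  have hprim := primitive_restr hd hac hℓ hf
  rw [hL (-ℓ) Set.self_mem_Iic] at hprim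
  set Y := leftSol q v (lam, κ) with hY
  have hy₀eq : y₀ = y (-ℓ) • Y := by
    have h := eq_of_primitive (EventuallyEq.refl _ _) hprim
    have h₁ : volterraOp q v (lam, κ) y₀ = y (-ℓ) • (1 + κ • ramp ℓ) := by
      change y₀ - volterra ℓ r y₀ = _
      nth_rw 1 [h]
      rw [smul_add, smul_smul, mul_comm κ]
      abel
    rw [eq_inverse_apply hp h₁, map_smul]
    rfl
  have hend : y ℓ = y (-ℓ) * Y ℓ := by
    have h := congrArg (fun g : ℝ →ᵇ ℝ => g ℓ) hy₀eq
    simpa only [hy₀, restr_apply, clamp_of_mem (show -ℓ ≤ ℓ by linarith) le_rfl,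
      BoundedContinuousFunction.smul_apply, smul_eq_mul] using h
  have ha : y (-ℓ) ≠ 0 := by
    intro h₀
    apply hx₀
    rcases le_total x₀ (-ℓ) with h₁ | h₁
    · exact eq_zero_of_deriv_eq_mul hd hL Set.self_mem_Iic h₀ x₀ h₁
    rcases le_total ℓ x₀ with h₂ | h₂
    · exact eq_zero_of_deriv_eq_mul hd hR Set.self_mem_Ici (by rw [hend, h₀, zero_mul]) x₀ h₂
    · have h := congrArg (fun g : ℝ →ᵇ ℝ => g x₀) hy₀eq
      simpa only [hy₀, restr_apply, clamp_of_mem h₁ h₂,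
        BoundedContinuousFunction.smul_apply, smul_eq_mul, h₀, zero_mul] using h
  have hend' := deriv_end_eq hac hℓ hf
  have hint : ∫ t, r t * y₀ t ∂slab ℓ = y (-ℓ) * pairing ℓ r Y := by
    rw [← pairing_apply, hy₀eq, map_smul, smul_eq_mul]
  rw [hint, hR ℓ Set.self_mem_Ici, hL (-ℓ) Set.self_mem_Iic, hend] at hend'
  rw [jostFun_eq hℓ hu hu' hp]
  simp only
  have : κ + pairing ℓ r Y + κ * Y ℓ = 0 := by
    refine (mul_eq_zero.1 (?_ : y (-ℓ) * _ = 0)).resolve_left ha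
    linear_combination -hend'
  rw [← hr, ← hY, this, mul_zero]

end Jost

/-! ### From zeros of the Jost function to eigenvalues -/

/-- A function whose second derivative and Cauchy data at one point are those of
`c exp (s (x - a))` coincides with it. -/
theorem eq_exp_of_ae_deriv_deriv_eq {y : ℝ → ℝ} (hd : Differentiable ℝ y)
    (hac : LocallyAC (deriv y)) {S : Set ℝ} [S.OrdConnected] {s c a : ℝ} (ha : a ∈ S)
    (hya : y a = c) (hya' : deriv y a = s * c)
    (h : ∀ᵐ x : ℝ, x ∈ S → deriv (deriv y) x = s ^ 2 * (c * Real.exp (s * (x - a)))) :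
    ∀ x ∈ S, y x = c * Real.exp (s * (x - a)) ∧
      deriv y x = s * (c * Real.exp (s * (x - a))) := by
  have hexp : ∀ t : ℝ, HasDerivAt (fun t => Real.exp (s * (t - a)))
      (s * Real.exp (s * (t - a))) t := fun t => by
    have h := (((hasDerivAt_id t).sub_const a).const_mul s).exp
    simpa [mul_comm] using h
  have hsub : ∀ x ∈ S, Set.uIoc a x ⊆ S := fun x hx =>
    Set.uIoc_subset_uIcc.trans (Set.OrdConnected.uIcc_subset ‹_› ha hx)
  have hder : ∀ x ∈ S, deriv y x = s * (c * Real.exp (s * (x - a))) := fun x hx => by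
    rw [deriv_eq_add_integral hac a x, intervalIntegral.integral_congr_ae
      (g := fun t => s ^ 2 * (c * Real.exp (s * (t - a))))]
    · have hi : ∀ t : ℝ, HasDerivAt (fun t => s * (c * Real.exp (s * (t - a))))
          (s ^ 2 * (c * Real.exp (s * (t - a)))) t := fun t => by
        convert! ((hexp t).const_mul c).const_mul s using 1
        ring
      rw [intervalIntegral.integral_eq_sub_of_hasDerivAt (fun t _ => hi t)
        (Continuous.intervalIntegrable (by fun_prop) _ _), hya']
      simp
    · filter_upwards [h] with t ht hmem using ht (hsub x hx hmem)
  refine fun x hx => ⟨?_, hder x hx⟩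
  rw [eq_add_integral_deriv hd hac a x, intervalIntegral.integral_congr_ae
    (g := fun t => s * (c * Real.exp (s * (t - a))))]
  · have hi : ∀ t : ℝ, HasDerivAt (fun t => c * Real.exp (s * (t - a)))
        (s * (c * Real.exp (s * (t - a)))) t := fun t => by
      convert! (hexp t).const_mul c using 1
      ring
    rw [intervalIntegral.integral_eq_sub_of_hasDerivAt (fun t _ => hi t)
      (Continuous.intervalIntegrable (by fun_prop) _ _), hya]
    simp
  · exact Eventually.of_forall fun t hmem => hder t (hsub x hx hmem)

theorem integrable_exp_neg_mul_abs {c : ℝ} (hc : 0 < c) :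
    Integrable (fun x : ℝ => Real.exp (-c * |x|)) := by
  rw [← integrableOn_univ, ← Set.Iic_union_Ioi (a := (0 : ℝ))]
  refine IntegrableOn.union ?_ ?_
  · refine (integrableOn_exp_mul_Iic hc 0).congr_fun (fun x hx => ?_) measurableSet_Iic
    simp only
    rw [abs_of_nonpos hx]
    ring_nf
  · refine (exp_neg_integrableOn_Ioi 0 hc).congr_fun (fun x hx => ?_) measurableSet_Ioi
    simp only
    rw [abs_of_pos hx]

theorem memLp_two_of_le_exp {f : ℝ → ℝ} (hf : Continuous f) {c C : ℝ} (hc : 0 < c)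
    (h : ∀ x, |f x| ≤ C * Real.exp (-c * |x|)) : MemLp f 2 volume := by
  have hg : MemLp (fun x : ℝ => C * Real.exp (-c * |x|)) 2 volume := by
    refine MemLp.const_mul ?_ C
    rw [memLp_two_iff_integrable_sq (Continuous.aestronglyMeasurable (by fun_prop))]
    refine (integrable_exp_neg_mul_abs (c := 2 * c) (by linarith)).congr
      (Eventually.of_forall fun x => ?_)
    simp only
    rw [← Real.exp_nat_mul]
    push_cast
    ring_nf
  exact hg.mono' hf.aestronglyMeasurable (Eventually.of_forall h)

/-- A real square integrable solution with square integrable derivatives yields an eigenvalue. -/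
theorem isSchrodingerEigenvalue_of_real {Q : ℝ → ℝ} {e : ℝ} {y : ℝ → ℝ}
    (hd : Differentiable ℝ y) (hac : LocallyAC (deriv y)) (hy : MemLp y 2 volume)
    (hy' : MemLp (deriv y) 2 volume) (hy'' : MemLp (deriv (deriv y)) 2 volume)
    (hne : ∃ x, y x ≠ 0) (heq : ∀ᵐ x : ℝ, deriv (deriv y) x = (Q x - e) * y x) :
    IsSchrodingerEigenvalue Q e := by
  have hderiv : deriv (fun x => (y x : ℂ)) = fun x => ((deriv y x : ℝ) : ℂ) :=
    funext fun x => ((hd x).hasDerivAt.ofReal_comp).deriv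
  have hderiv₂ : deriv (deriv (fun x => (y x : ℂ)))
      =ᵐ[volume] fun x => ((deriv (deriv y) x : ℝ) : ℂ) := by
    rw [hderiv]
    filter_upwards [hac.ae_differentiableAt] with x hx using (hx.hasDerivAt.ofReal_comp).deriv
  refine ⟨fun x => (y x : ℂ), ⟨fun x => ((hd x).hasDerivAt.ofReal_comp).differentiableAt,
    ?_, hy.ofReal, ?_, ?_⟩, ?_, ?_⟩
  · rw [hderiv]
    exact hac.clm_comp Complex.ofRealCLM
  · rw [hderiv]
    exact hy'.ofReal
  · exact (memLp_congr_ae hderiv₂).2 hy''.ofReal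
  · intro h₀
    obtain ⟨x, hx⟩ := hne
    have hc : Continuous fun x => (y x : ℂ) := Complex.continuous_ofReal.comp hd.continuous
    have := (hc.ae_eq_iff_eq volume continuous_zero).1 h₀
    exact hx (Complex.ofReal_eq_zero.1 (congrFun this x))
  · filter_upwards [heq, hderiv₂] with x h₁ h₂
    rw [h₂, h₁]
    push_cast
    ring

/-- The exponentially decaying continuation of a function on `[-ℓ, ℓ]`. -/
def expExtension (ℓ κ : ℝ) (y : ℝ →ᵇ ℝ) (x : ℝ) : ℝ :=
  y (clamp ℓ x) * Real.exp (-κ * |x - clamp ℓ x|)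

section Extension

variable {ℓ κ : ℝ} {y : ℝ →ᵇ ℝ}

theorem continuous_expExtension : Continuous (expExtension ℓ κ y) := by
  unfold expExtension
  fun_prop

theorem expExtension_of_le (hℓ : 0 ≤ ℓ) {x : ℝ} (hx : x ≤ -ℓ) :
    expExtension ℓ κ y x = y (-ℓ) * Real.exp (κ * (x - -ℓ)) := by
  have h : clamp ℓ x = -ℓ := by unfold clamp; grind
  rw [expExtension, h, abs_of_nonpos (by linarith)]
  ring_nf

theorem expExtension_of_ge (hℓ : 0 ≤ ℓ) {x : ℝ} (hx : ℓ ≤ x) :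
    expExtension ℓ κ y x = y ℓ * Real.exp (-κ * (x - ℓ)) := by
  have h : clamp ℓ x = ℓ := by unfold clamp; grind
  rw [expExtension, h, abs_of_nonneg (by linarith)]

theorem expExtension_of_mem {x : ℝ} (h₁ : -ℓ ≤ x) (h₂ : x ≤ ℓ) :
    expExtension ℓ κ y x = y x := by
  rw [expExtension, clamp_of_mem h₁ h₂, sub_self, abs_zero, mul_zero, Real.exp_zero, mul_one]

theorem abs_expExtension_le (hκ : 0 < κ) (x : ℝ) :
    |expExtension ℓ κ y x| ≤ ‖y‖ * Real.exp (κ * |ℓ|) * Real.exp (-κ * |x|) := by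
  have h₁ : |x| - |ℓ| ≤ |x - clamp ℓ x| := by
    have := abs_sub_abs_le_abs_sub x (clamp ℓ x)
    linarith [abs_clamp_le ℓ x]
  rw [expExtension, abs_mul, Real.abs_exp, mul_assoc, ← Real.exp_add]
  refine mul_le_mul (y.norm_coe_le_norm _) (Real.exp_le_exp.2 ?_) (Real.exp_pos _).le
    (norm_nonneg _)
  nlinarith

end Extension

/-- The exponential continuation of `leftSol` at a zero of the Jost function is an
eigenfunction. -/
theorem isSchrodingerEigenvalue_of_end_condition {ℓ κ : ℝ} (hℓ : 0 ≤ ℓ) (hκ : 0 < κ) {Q : ℝ → ℝ}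
    (hQ₂ : MemLp Q 2 volume) (hQs : EssSupportedIn Q ℓ) {r : Lp ℝ 2 (slab ℓ)}
    (hr : ∀ᵐ t ∂slab ℓ, r t = Q t + κ ^ 2) {Y : ℝ →ᵇ ℝ}
    (hY : Y = 1 + κ • ramp ℓ + volterra ℓ r Y) (hend : κ + pairing ℓ r Y + κ * Y ℓ = 0) :
    IsSchrodingerEigenvalue Q (-κ ^ 2) := by
  set G := expExtension ℓ κ Y with hG
  have hGc : Continuous G := continuous_expExtension
  set f : ℝ → ℝ := fun t => (Q t + κ ^ 2) * G t with hf
  have hYp : Primitive ℓ 1 κ (fun t => r t * Y t) Y := primitive_of_eq (by rwa [one_smul])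
  have hfr : f =ᵐ[slab ℓ] fun t => r t * Y t := by
    filter_upwards [hr, ae_slab_mem ℓ] with t h₁ h₂
    rw [hf, h₁, hG]
    simp only
    rw [expExtension_of_mem h₂.1.le h₂.2]
  have hfi : ∀ a b, IntervalIntegrable f volume a b := fun a b => by
    have h₁ : IntervalIntegrable Q volume a b :=
      ((hQ₂.locallyIntegrable (by norm_num)).integrableOn_isCompact
        isCompact_uIcc).intervalIntegrable
    exact (h₁.add intervalIntegrable_const).mul_continuousOn hGc.continuousOn
  set P : ℝ → ℝ := fun x => κ + ∫ t in (-ℓ)..x, f t with hP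
  have hPac : LocallyAC P := fun a b => by
    have h₁ : AbsolutelyContinuousOnInterval (fun _ : ℝ => κ) a b :=
      (ContDiff.contDiffOn (by fun_prop)).absolutelyContinuousOnInterval
    exact h₁.add (LocallyAC.integral hfi (-ℓ) a b)
  set y : ℝ → ℝ := fun x => 1 + ∫ t in (-ℓ)..x, P t with hy
  have hyP : ∀ x, HasDerivAt y (P x) x := fun x =>
    (intervalIntegral.integral_hasDerivAt_right (hPac.continuous.intervalIntegrable _ _)
      (hPac.continuous.stronglyMeasurableAtFilter _ _) hPac.continuous.continuousAt).const_add 1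
  have hd : Differentiable ℝ y := fun x => (hyP x).differentiableAt
  have hderiv : deriv y = P := funext fun x => (hyP x).deriv
  have hac : LocallyAC (deriv y) := hderiv ▸ hPac
  have hyf : ∀ᵐ x : ℝ, deriv (deriv y) x = f x := by
    rw [hderiv]
    filter_upwards [ae_hasDerivAt_integral hfi (-ℓ)] with x hx using (hx.const_add κ).deriv
  have hyl : y (-ℓ) = 1 := by simp [hy]
  have hyl' : deriv y (-ℓ) = κ := by rw [hderiv]; simp [hP]
  have hYl : Y (-ℓ) = 1 := by
    have h₁ := hYp.eq (-ℓ)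
    rw [integral_kern_mul le_rfl (by linarith), intervalIntegral.integral_same, ramp_apply,
      clamp_of_mem le_rfl (by linarith)] at h₁
    rw [h₁]
    ring
  -- `f` was built from `G`, not from `y`; that `y = G` has to be checked on each of the three
  -- intervals, and on the right one this is where the end condition enters.
  have hL := eq_exp_of_ae_deriv_deriv_eq hd hac (S := Set.Iic (-ℓ)) (s := κ)
    Set.self_mem_Iic hyl (by rw [hyl', mul_one]) (by
      filter_upwards [hyf, ae_mem_Iic_of_essSupportedIn hQs] with x h₁ h₂ hx
      rw [h₁, hf]
      simp only
      rw [h₂ hx, hG, expExtension_of_le hℓ hx, hYl, zero_add])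
  have hyf' : deriv (deriv y) =ᵐ[slab ℓ] fun t => r t * Y t :=
    EventuallyEq.trans (ae_restrict_of_ae hyf) hfr
  have hM : restr ℓ y hd.continuous = Y := by
    ext x
    have h := (primitive_restr hd hac hℓ hyf').eq x
    rw [h, hYp.eq x, hyl, hyl']
  have hM' : ∀ x, -ℓ ≤ x → x ≤ ℓ → y x = Y x := fun x h₁ h₂ => by
    rw [← hM, restr_apply, clamp_of_mem h₁ h₂]
  have hyr' : deriv y ℓ = -κ * Y ℓ := by
    rw [deriv_end_eq hac hℓ hyf', hyl', ← pairing_apply]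
    linear_combination hend
  have hR := eq_exp_of_ae_deriv_deriv_eq hd hac (S := Set.Ici ℓ) (s := -κ)
    Set.self_mem_Ici (hM' ℓ (by linarith) le_rfl) hyr' (by
      filter_upwards [hyf, ae_mem_Ici_of_essSupportedIn hQs] with x h₁ h₂ hx
      rw [h₁, hf]
      simp only
      rw [h₂ hx, hG, expExtension_of_ge hℓ hx, zero_add, neg_sq])
  have hyG : y = G := funext fun x => by
    rcases le_total x (-ℓ) with h₁ | h₁
    · rw [(hL x h₁).1, hG, expExtension_of_le hℓ h₁, hYl]
    rcases le_total ℓ x with h₂ | h₂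
    · rw [(hR x h₂).1, hG, expExtension_of_ge hℓ h₂]
    · rw [hM' x h₁ h₂, hG, expExtension_of_mem h₁ h₂]
  have hybound : ∀ x, |y x| ≤ ‖Y‖ * Real.exp (κ * |ℓ|) * Real.exp (-κ * |x|) := fun x => by
    rw [hyG]; exact abs_expExtension_le hκ x
  have hyL : MemLp y 2 volume := memLp_two_of_le_exp hd.continuous hκ hybound
  have hyL' : MemLp (deriv y) 2 volume := by
    obtain ⟨B, hB⟩ := (isCompact_Icc (a := -ℓ) (b := ℓ)).exists_bound_of_continuousOn
      hac.continuous.continuousOn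
    have hB₀ : 0 ≤ B := (norm_nonneg _).trans (hB ℓ ⟨by linarith, le_rfl⟩)
    refine memLp_two_of_le_exp hac.continuous hκ
      (C := κ * (‖Y‖ * Real.exp (κ * |ℓ|)) + B * Real.exp (κ * |ℓ|)) fun x => ?_
    have hout : |deriv y x| = κ * |y x| →
        |deriv y x| ≤ (κ * (‖Y‖ * Real.exp (κ * |ℓ|)) + B * Real.exp (κ * |ℓ|))
          * Real.exp (-κ * |x|) := fun h => by
      rw [h, add_mul, mul_assoc]
      have h₁ := mul_le_mul_of_nonneg_left (hybound x) hκ.le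
      have h₂ : 0 ≤ B * Real.exp (κ * |ℓ|) * Real.exp (-κ * |x|) := by positivity
      linarith
    rcases le_total x (-ℓ) with h₁ | h₁
    · exact hout (by rw [(hL x h₁).2, (hL x h₁).1, abs_mul, abs_of_pos hκ])
    rcases le_total ℓ x with h₂ | h₂
    · exact hout (by rw [(hR x h₂).2, (hR x h₂).1, abs_mul, abs_neg, abs_of_pos hκ])
    · have h₃ : 1 ≤ Real.exp (κ * |ℓ|) * Real.exp (-κ * |x|) := by
        rw [← Real.exp_add]
        refine Real.one_le_exp ?_
        have : |x| ≤ |ℓ| := (abs_le.2 ⟨h₁, h₂⟩).trans (le_abs_self ℓ)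
        nlinarith
      have h₄ := hB x ⟨h₁, h₂⟩
      rw [Real.norm_eq_abs] at h₄
      have h₅ : 0 ≤ κ * (‖Y‖ * Real.exp (κ * |ℓ|)) * Real.exp (-κ * |x|) := by positivity
      rw [add_mul, mul_assoc B]
      have h₆ := mul_le_mul_of_nonneg_left h₃ hB₀
      linarith
  have hyL'' : MemLp (deriv (deriv y)) 2 volume := by
    refine (memLp_congr_ae (g := fun x => κ ^ 2 * y x + Q x * G x) ?_).2
      ((hyL.const_mul _).add ?_)
    · filter_upwards [hyf] with x hx
      rw [hx, hf, hyG]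
      ring
    · refine (hQ₂.const_mul (‖Y‖ * Real.exp (κ * |ℓ|))).norm.mono'
        (hQ₂.aestronglyMeasurable.mul hGc.aestronglyMeasurable)
        (Eventually.of_forall fun x => ?_)
      have h₁ := hybound x
      rw [hyG] at h₁
      have h₂ : Real.exp (-κ * |x|) ≤ 1 := Real.exp_le_one_iff.2 (by
        have := abs_nonneg x
        nlinarith)
      have h₃ : 0 ≤ ‖Y‖ * Real.exp (κ * |ℓ|) := by positivity
      have h₄ : |G x| ≤ ‖Y‖ * Real.exp (κ * |ℓ|) :=
        h₁.trans (mul_le_of_le_one_right h₃ h₂)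
      rw [norm_mul, norm_mul, Real.norm_eq_abs, Real.norm_eq_abs, Real.norm_eq_abs,
        abs_of_nonneg h₃, mul_comm]
      gcongr
  refine isSchrodingerEigenvalue_of_real hd hac hyL hyL' hyL''
    ⟨-ℓ, by rw [hyl]; exact one_ne_zero⟩ ?_
  filter_upwards [hyf] with x hx
  rw [hx, hf, hyG]
  simp only
  ring

/-! ### Potentials on the interval -/

theorem EssSupportedIn.mono {f : ℝ → ℝ} {a b : ℝ} (h : EssSupportedIn f a) (hab : a ≤ b) :
    EssSupportedIn f b := by
  filter_upwards [h] with x hx hb using hx (hab.trans_lt hb)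

theorem ae_notMem_Ioc_of_essSupportedIn {f : ℝ → ℝ} {ℓ : ℝ} (h : EssSupportedIn f ℓ) :
    ∀ᵐ x : ℝ, x ∉ Set.Ioc (-ℓ) ℓ → f x = 0 := by
  filter_upwards [ae_mem_Iic_of_essSupportedIn h, ae_mem_Ici_of_essSupportedIn h]
    with x h₁ h₂ hx
  rcases le_or_gt x (-ℓ) with h₃ | h₃
  · exact h₁ h₃
  · exact h₂ (by by_contra h₄; exact hx ⟨h₃, (not_le.1 h₄).le⟩)

theorem BoundedCompactlySupported.memLp_two {f : ℝ → ℝ} (hf : BoundedCompactlySupported f) :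
    MemLp f 2 volume := by
  obtain ⟨h, ℓ, hℓ⟩ := hf
  have h₁ : MemLp f 2 (slab ℓ) := (h.restrict _).mono_exponent le_top
  have h₂ := (memLp_indicator_iff_restrict (measurableSet_Ioc (a := -ℓ) (b := ℓ))).2 h₁
  refine (memLp_congr_ae ?_).1 h₂
  filter_upwards [ae_notMem_Ioc_of_essSupportedIn hℓ] with x hx
  by_cases hm : x ∈ Set.Ioc (-ℓ) ℓ
  · rw [Set.indicator_of_mem hm]
  · rw [Set.indicator_of_notMem hm, hx hm]

open Classical in
/-- The class in `L²(-ℓ, ℓ)` of a square integrable function; `0` for other functions. -/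
def toSlab (ℓ : ℝ) (f : ℝ → ℝ) : Lp ℝ 2 (slab ℓ) :=
  if h : MemLp f 2 (slab ℓ) then h.toLp f else 0

theorem coeFn_toSlab {ℓ : ℝ} {f : ℝ → ℝ} (hf : MemLp f 2 volume) :
    ∀ᵐ t ∂slab ℓ, toSlab ℓ f t = f t := by
  rw [toSlab, dif_pos (hf.restrict _)]
  exact (hf.restrict _).coeFn_toLp

theorem norm_toSlab_le {ℓ : ℝ} {f : ℝ → ℝ} (hf : MemLp f 2 volume) :
    ‖toSlab ℓ f‖ ≤ (eLpNorm f 2 volume).toReal := by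
  rw [toSlab, dif_pos (hf.restrict _), Lp.norm_toLp]
  exact ENNReal.toReal_mono hf.eLpNorm_ne_top (eLpNorm_mono_measure _ Measure.restrict_le_self)

theorem toSlab_eq {ℓ : ℝ} {f : ℝ → ℝ} (hf : MemLp f 2 volume) :
    toSlab ℓ f = (hf.restrict (Set.Ioc (-ℓ) ℓ)).toLp f := dif_pos _

theorem pairing_toSlab {ℓ : ℝ} {f : ℝ → ℝ} (hf : MemLp f 2 volume)
    (hs : EssSupportedIn f ℓ) {g : ℝ →ᵇ ℝ} {h : ℝ → ℝ} (hg : ∀ x, g x = h (clamp ℓ x)) :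
    pairing ℓ (toSlab ℓ f) g = ∫ x, f x * h x := by
  have e : ∫ x in Set.Ioc (-ℓ) ℓ, f x * h x = ∫ x, f x * h x := by
    refine setIntegral_eq_integral_of_ae_compl_eq_zero ?_
    filter_upwards [ae_notMem_Ioc_of_essSupportedIn hs] with x h₁ h₂
    rw [h₁ h₂, zero_mul]
  rw [pairing_apply, ← e]
  refine integral_congr_ae ?_
  filter_upwards [coeFn_toSlab (ℓ := ℓ) hf, ae_slab_clamp ℓ] with t h₁ h₂
  rw [h₁, hg, h₂]

/-! ### Solutions outside the support of the potential -/

theorem eq_zero_of_affine_bounded {a s C : ℝ} (h : ∀ t : ℝ, 0 ≤ t → |a + s * t| ≤ C) : s = 0 := by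
  by_contra hs
  have hs' : 0 < |s| := abs_pos.2 hs
  have hC : 0 ≤ C := (abs_nonneg _).trans (h 0 le_rfl)
  have h₁ := h ((C + |a| + 1) / |s|) (by positivity)
  have h₂ : |s * ((C + |a| + 1) / |s|)| = C + |a| + 1 := by
    rw [abs_mul, abs_of_nonneg (a := (C + |a| + 1) / |s|) (by positivity)]
    field_simp
  have h₃ := abs_sub_abs_le_abs_sub (s * ((C + |a| + 1) / |s|)) (-a)
  rw [abs_neg, h₂, sub_neg_eq_add, add_comm (s * _)] at h₃
  linarith

section Affine

variable {U f y : ℝ → ℝ} {ℓ : ℝ}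

theorem IsSolution.ae_deriv_deriv_eq (h : IsSolution U f y) :
    ∀ᵐ x : ℝ, deriv (deriv y) x = U x * y x - f x := by
  filter_upwards [h.eqn] with x hx
  linarith

theorem IsSolution.affine_left (h : IsSolution U f y) (hU : EssSupportedIn U ℓ)
    (hf : EssSupportedIn f ℓ) {x : ℝ} (hx : x ≤ -ℓ) :
    y x = y (-ℓ) + deriv y (-ℓ) * (x - -ℓ) := by
  refine eq_affine_of_ae_deriv_deriv_eq_zero h.differentiable h.deriv_ac ?_
  filter_upwards [h.ae_deriv_deriv_eq, ae_mem_Iic_of_essSupportedIn hU,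
    ae_mem_Iic_of_essSupportedIn hf] with t h₁ h₂ h₃ ht
  rw [Set.uIoc_of_ge hx] at ht
  rw [h₁, h₂ ht.2, h₃ ht.2]
  ring

theorem IsSolution.affine_right (h : IsSolution U f y) (hU : EssSupportedIn U ℓ)
    (hf : EssSupportedIn f ℓ) {x : ℝ} (hx : ℓ ≤ x) :
    y x = y ℓ + deriv y ℓ * (x - ℓ) := by
  refine eq_affine_of_ae_deriv_deriv_eq_zero h.differentiable h.deriv_ac ?_
  filter_upwards [h.ae_deriv_deriv_eq, ae_mem_Ici_of_essSupportedIn hU,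
    ae_mem_Ici_of_essSupportedIn hf] with t h₁ h₂ h₃ ht
  rw [Set.uIoc_of_le hx] at ht
  rw [h₁, h₂ ht.1.le, h₃ ht.1.le]
  ring

/-- A solution that is eventually affine on the left is so up to the support of the potential. -/
theorem IsSolution.initial_values (h : IsSolution U f y) (hU : EssSupportedIn U ℓ)
    (hf : EssSupportedIn f ℓ) {s : ℝ} (hy : ∀ᶠ x in atBot, y x = s * x) :
    y (-ℓ) = -(s * ℓ) ∧ deriv y (-ℓ) = s := by
  obtain ⟨N, hN⟩ := eventually_atBot.1 hy
  set a := min N (-ℓ) with ha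
  have ha₁ : a ≤ N := min_le_left _ _
  have ha₂ : a ≤ -ℓ := min_le_right _ _
  have e₁ := h.affine_left hU hf ha₂
  have e₂ := h.affine_left hU hf (show a - 1 ≤ -ℓ by linarith)
  rw [hN a ha₁] at e₁
  rw [hN (a - 1) (by linarith)] at e₂
  have e₃ : deriv y (-ℓ) = s := by linarith
  refine ⟨?_, e₃⟩
  rw [e₃] at e₁
  linarith

theorem essSupportedIn_zero : EssSupportedIn 0 ℓ := Eventually.of_forall fun _ _ => rfl

theorem IsHalfBoundState.deriv_left (h : IsHalfBoundState U y) (hU : EssSupportedIn U ℓ) :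
    deriv y (-ℓ) = 0 := by
  obtain ⟨C, hC⟩ := h.bounded
  refine neg_eq_zero.1 (eq_zero_of_affine_bounded (a := y (-ℓ)) (C := C) fun t ht => ?_)
  have e := h.solution.affine_left hU essSupportedIn_zero (show -ℓ - t ≤ -ℓ by linarith)
  have : y (-ℓ) + -deriv y (-ℓ) * t = y (-ℓ - t) := by rw [e]; ring
  rw [this]
  exact hC _

theorem IsHalfBoundState.deriv_right (h : IsHalfBoundState U y) (hU : EssSupportedIn U ℓ) :
    deriv y ℓ = 0 := by
  obtain ⟨C, hC⟩ := h.bounded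
  refine eq_zero_of_affine_bounded (a := y ℓ) (C := C) fun t ht => ?_
  have e := h.solution.affine_right hU essSupportedIn_zero (show ℓ ≤ ℓ + t by linarith)
  have : y ℓ + deriv y ℓ * t = y (ℓ + t) := by rw [e]; ring
  rw [this]
  exact hC _

theorem IsHalfBoundState.eq_right (h : IsHalfBoundState U y) (hU : EssSupportedIn U ℓ) {x : ℝ}
    (hx : ℓ ≤ x) : y x = y ℓ := by
  rw [h.solution.affine_right hU essSupportedIn_zero hx, h.deriv_right hU, zero_mul, add_zero]

theorem IsNormalizedHalfBoundState.eq_left (h : IsNormalizedHalfBoundState U y)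
    (hU : EssSupportedIn U ℓ) {x : ℝ} (hx : x ≤ -ℓ) : y x = 1 := by
  have hconst : ∀ x ≤ -ℓ, y x = y (-ℓ) := fun x hx => by
    rw [h.solution.affine_left hU essSupportedIn_zero hx, h.deriv_left hU, zero_mul, add_zero]
  have : Tendsto y atBot (𝓝 (y (-ℓ))) := tendsto_const_nhds.congr'
    ((eventually_le_atBot (-ℓ)).mono fun x hx => (hconst x hx).symm)
  rw [hconst x hx, tendsto_nhds_unique this h.normalized]

end Affine

/-! ### The step function -/

theorem integral_sq_stepTheta {ℓ : ℝ} (hℓ : 0 ≤ ℓ) (θ : ℝ) :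
    Integrable (fun x => stepTheta θ x ^ 2) (slab ℓ) ∧
      ∫ x, stepTheta θ x ^ 2 ∂slab ℓ = ℓ * (1 + θ ^ 2) := by
  have h₁ : ∀ᵐ t : ℝ, t ∈ Set.uIoc (-ℓ) 0 → stepTheta θ t ^ 2 = 1 := by
    filter_upwards [Measure.ae_ne volume (0 : ℝ)] with t hne ht
    rw [Set.uIoc_of_le (by linarith)] at ht
    rw [stepTheta, if_pos (lt_of_le_of_ne ht.2 hne), one_pow]
  have h₂ : ∀ᵐ t : ℝ, t ∈ Set.uIoc 0 ℓ → stepTheta θ t ^ 2 = θ ^ 2 := by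
    refine Eventually.of_forall fun t ht => ?_
    rw [Set.uIoc_of_le hℓ] at ht
    rw [stepTheta, if_neg (not_lt.2 ht.1.le)]
  have i₁ : IntervalIntegrable (fun x => stepTheta θ x ^ 2) volume (-ℓ) 0 :=
    (intervalIntegrable_const (c := (1 : ℝ))).congr_ae ((ae_restrict_iff' measurableSet_uIoc).2
      (h₁.mono fun t h ht => (h ht).symm))
  have i₂ : IntervalIntegrable (fun x => stepTheta θ x ^ 2) volume 0 ℓ :=
    (intervalIntegrable_const (c := θ ^ 2)).congr_ae ((ae_restrict_iff' measurableSet_uIoc).2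
      (h₂.mono fun t h ht => (h ht).symm))
  refine ⟨(intervalIntegrable_iff_integrableOn_Ioc_of_le (by linarith)).1 (i₁.trans i₂), ?_⟩
  rw [integral_slab_eq_intervalIntegral hℓ, ← intervalIntegral.integral_add_adjacent_intervals
    i₁ i₂, intervalIntegral.integral_congr_ae h₁, intervalIntegral.integral_congr_ae h₂]
  simp
  ring

/-- The regularized integral `∫ (u² - Θ²)` over the line in terms of the interval. -/
theorem integral_sq_sub_stepTheta {ℓ : ℝ} (hℓ : 0 < ℓ) {u : ℝ → ℝ} {û : ℝ →ᵇ ℝ} {θ : ℝ}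
    (hû : ∀ x, û x = u (clamp ℓ x)) (hl : ∀ x ≤ -ℓ, u x = 1) (hr : ∀ x, ℓ ≤ x → u x = θ) :
    ∫ x, (u x ^ 2 - stepTheta θ x ^ 2)
      = pairing ℓ (oneLp ℓ) (û * û) - ℓ * (1 + θ ^ 2) := by
  obtain ⟨hi, hv⟩ := integral_sq_stepTheta hℓ.le θ
  rw [← setIntegral_eq_integral_of_forall_compl_eq_zero (s := Set.Ioc (-ℓ) ℓ), pairing_apply,
    ← hv, ← integral_sub (integrable_Lp_mul _ _) hi]
  · refine integral_congr_ae ?_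
    filter_upwards [coeFn_oneLp ℓ, ae_slab_clamp ℓ] with t h₁ h₂
    rw [h₁, BoundedContinuousFunction.mul_apply, hû, h₂]
    ring
  · intro x hx
    rcases le_or_gt x (-ℓ) with h | h
    · rw [hl x h, stepTheta, if_pos (by linarith)]
      ring
    · have h' : ℓ ≤ x := by
        by_contra h'
        exact hx ⟨h, (not_le.1 h').le⟩
      rw [hr x h', stepTheta, if_neg (by linarith)]
      ring

/-! ### The half-bound state and the correctors on the interval -/

section Interval

variable {ℓ : ℝ} {U u : ℝ → ℝ}

theorem isUnit_one_sub_volterra_toSlab (hℓ : 0 ≤ ℓ) (hU : BoundedCompactlySupported U) :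
    IsUnit (1 - volterra ℓ (toSlab ℓ U)) := by
  refine isUnit_one_sub_volterra (M := (eLpNorm U ⊤ volume).toReal) hℓ ?_
  have h : ∀ᵐ x : ℝ, |U x| ≤ (eLpNorm U ⊤ volume).toReal := by
    filter_upwards [enorm_ae_le_eLpNormEssSup U volume] with x hx
    rw [← eLpNorm_exponent_top] at hx
    have := ENNReal.toReal_mono hU.1.eLpNorm_ne_top hx
    rwa [toReal_enorm] at this
  filter_upwards [ae_restrict_of_ae h, coeFn_toSlab (ℓ := ℓ) hU.memLp_two] with t h₁ h₂
  rwa [h₂]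

theorem primitive_halfBoundState (hℓ : 0 ≤ ℓ) (hU : BoundedCompactlySupported U)
    (hUs : EssSupportedIn U ℓ) (hu : IsNormalizedHalfBoundState U u) {û : ℝ →ᵇ ℝ}
    (hû : û = restr ℓ u hu.solution.differentiable.continuous) :
    Primitive ℓ 1 0 (fun t => toSlab ℓ U t * û t) û ∧
      ∫ t, toSlab ℓ U t * û t ∂slab ℓ = 0 := by
  have hf : deriv (deriv u) =ᵐ[slab ℓ] fun t => toSlab ℓ U t * û t := by
    filter_upwards [ae_restrict_of_ae hu.solution.ae_deriv_deriv_eq,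
      coeFn_toSlab (ℓ := ℓ) hU.memLp_two, ae_slab_clamp ℓ] with t h₁ h₂ h₃
    rw [h₁, h₂, hû, restr_apply, h₃]
    simp
  have h₁ := primitive_restr hu.solution.differentiable hu.solution.deriv_ac hℓ hf
  have h₂ := deriv_end_eq hu.solution.deriv_ac hℓ hf
  rw [hu.deriv_left hUs, ← hû, hu.eq_left hUs le_rfl] at h₁
  rw [hu.deriv_left hUs, hu.deriv_right hUs, zero_add] at h₂
  exact ⟨h₁, h₂.symm⟩

theorem tendsto_toSlab {V V₁ : ℝ → ℝ} {Vl : ℝ → ℝ → ℝ} (hV : MemLp V 2 volume)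
    (hV₁ : MemLp V₁ 2 volume) (hVl : ∀ᶠ lam in 𝓝[>] (0 : ℝ), MemLp (Vl lam) 2 volume)
    (hexp : (fun lam : ℝ =>
        (eLpNorm (fun x => Vl lam x - V x - lam * V₁ x) 2 volume).toReal)
          =o[𝓝[>] (0 : ℝ)] (fun lam : ℝ => lam)) :
    Tendsto (fun lam => toSlab ℓ (Vl lam)) (𝓝[>] 0) (𝓝 (toSlab ℓ V)) ∧
      Tendsto (fun lam : ℝ => lam⁻¹ • (toSlab ℓ (Vl lam) - toSlab ℓ V)) (𝓝[>] 0)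
        (𝓝 (toSlab ℓ V₁)) := by
  have hpos : ∀ᶠ lam in 𝓝[>] (0 : ℝ), 0 < lam := self_mem_nhdsWithin
  have h₁ : Tendsto (fun lam : ℝ => lam⁻¹ • (toSlab ℓ (Vl lam) - toSlab ℓ V)) (𝓝[>] 0)
        (𝓝 (toSlab ℓ V₁)) := by
    rw [tendsto_iff_norm_sub_tendsto_zero]
    refine squeeze_zero' (Eventually.of_forall fun _ => norm_nonneg _) ?_
      hexp.tendsto_div_nhds_zero
    filter_upwards [hpos, hVl] with lam hlam hm
    have hd : MemLp (fun x => Vl lam x - V x - lam * V₁ x) 2 volume :=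
      (hm.sub hV).sub (hV₁.const_mul lam)
    have e : toSlab ℓ (Vl lam) - toSlab ℓ V - lam • toSlab ℓ V₁
        = toSlab ℓ (fun x => Vl lam x - V x - lam * V₁ x) := by
      rw [toSlab_eq hm, toSlab_eq hV, toSlab_eq hV₁, toSlab_eq hd]
      rfl
    have e' : lam⁻¹ • (toSlab ℓ (Vl lam) - toSlab ℓ V) - toSlab ℓ V₁
        = lam⁻¹ • toSlab ℓ (fun x => Vl lam x - V x - lam * V₁ x) := by
      rw [← e, smul_sub _ _ (lam • toSlab ℓ V₁), smul_smul, inv_mul_cancel₀ hlam.ne', one_smul]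
    rw [e', norm_smul, norm_inv, Real.norm_eq_abs, abs_of_pos hlam, div_eq_inv_mul]
    exact mul_le_mul_of_nonneg_left (norm_toSlab_le hd) (inv_pos.2 hlam).le
  refine ⟨?_, h₁⟩
  have hid : Tendsto (fun lam : ℝ => lam) (𝓝[>] 0) (𝓝 0) :=
    tendsto_id.mono_left nhdsWithin_le_nhds
  have h₂ := (hid.smul h₁).const_add (toSlab ℓ V)
  rw [zero_smul, add_zero] at h₂
  refine h₂.congr' ?_
  filter_upwards [hpos] with lam hlam
  rw [smul_smul, mul_inv_cancel₀ hlam.ne', one_smul]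
  abel

theorem coeFn_toSlab_add_smul {W : ℝ → ℝ} {lam : ℝ} (hU : MemLp U 2 volume)
    (hW : MemLp W 2 volume) :
    ∀ᵐ t ∂slab ℓ, (toSlab ℓ U + lam • toSlab ℓ W) t = U t + lam * W t := by
  filter_upwards [Lp.coeFn_add (toSlab ℓ U) (lam • toSlab ℓ W), Lp.coeFn_smul lam (toSlab ℓ W),
    coeFn_toSlab (ℓ := ℓ) hU, coeFn_toSlab (ℓ := ℓ) hW] with t h₁ h₂ h₃ h₄
  rw [h₁, Pi.add_apply, h₂, Pi.smul_apply, h₃, h₄, smul_eq_mul]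

theorem essSupportedIn_add_mul {W : ℝ → ℝ} {lam : ℝ} (hU : EssSupportedIn U ℓ)
    (hW : EssSupportedIn W ℓ) : EssSupportedIn (fun x => U x + lam * W x) ℓ := by
  filter_upwards [hU, hW] with x h₁ h₂ hx
  rw [h₁ hx, h₂ hx, mul_zero, add_zero]

end Interval

section Family

variable {ℓ : ℝ} {U u : ℝ → ℝ} {Vl : ℝ → ℝ → ℝ} {v₀ : Lp ℝ 2 (slab ℓ)} {û : ℝ →ᵇ ℝ}

/-- Zeros of the Jost function near the threshold give a family of threshold eigenvalues. -/
theorem exists_isThresholdEigenvalue (hℓ : 0 ≤ ℓ) (hU : MemLp U 2 volume)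
    (hUs : EssSupportedIn U ℓ) (hVl : ∀ᶠ lam in 𝓝[>] (0 : ℝ), MemLp (Vl lam) 2 volume)
    (hVls : ∀ᶠ lam in 𝓝[>] (0 : ℝ), EssSupportedIn (Vl lam) ℓ)
    (hv : Tendsto (fun lam => toSlab ℓ (Vl lam)) (𝓝[>] 0) (𝓝 v₀))
    (hq : IsUnit (1 - volterra ℓ (toSlab ℓ U)))
    (hu : Primitive ℓ 1 0 (fun t => toSlab ℓ U t * û t) û)
    (hu' : ∫ t, toSlab ℓ U t * û t ∂slab ℓ = 0) (hneg : pairing ℓ v₀ (û * û) < 0) :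
    ∃ e : ℝ → ℝ, IsThresholdEigenvalue (fun lam x => U x + lam * Vl lam x) e := by
  classical
  set q := toSlab ℓ U with hqdef
  set v : ℝ → Lp ℝ 2 (slab ℓ) := fun lam => toSlab ℓ (Vl lam) with hvdef
  have huq : û = 1 + volterra ℓ q û := by
    have h := eq_of_primitive (EventuallyEq.refl _ _) hu
    rwa [one_smul, zero_smul, add_zero] at h
  obtain ⟨M, hM⟩ := exists_jostFun_eq_zero hv hq huq hneg
  set p : ℝ → ℝ → Prop := fun lam κ => 0 < κ ∧ κ ≤ M * lam ∧
      IsUnit (volterraOp q v (lam, κ)) ∧ jostFun q v û (lam, κ) = 0 with hp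
  set κ : ℝ → ℝ := fun lam => if h : ∃ κ, p lam κ then h.choose else 0 with hκ
  have hκp : ∀ᶠ lam in 𝓝[>] (0 : ℝ), p lam (κ lam) := by
    filter_upwards [hM] with lam h
    have h' : ∃ κ, p lam κ := h
    rw [hκ]
    simp only [dif_pos h']
    exact h'.choose_spec
  refine ⟨fun lam => -κ lam ^ 2, ?_, ?_⟩
  · filter_upwards [hκp, hVl, hVls] with lam h h₁ h₂
    obtain ⟨hpos, -, hunit, hzero⟩ := h
    refine ⟨by have := pow_pos hpos 2; linarith, ?_⟩
    rw [jostFun_eq hℓ hu hu' hunit] at hzero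
    have hend := (mul_eq_zero.1 hzero).resolve_left (end_ne_zero hℓ hq hu hu')
    refine isSchrodingerEigenvalue_of_end_condition hℓ hpos (hU.add (h₁.const_mul lam))
      (essSupportedIn_add_mul hUs h₂) (r := q + perturbation v (lam, κ lam)) ?_
      (leftSol_eq hunit) hend
    exact coeFn_add_perturbation (coeFn_toSlab_add_smul hU h₁)
  · have hid : Tendsto (fun lam : ℝ => M * lam) (𝓝[>] 0) (𝓝 0) := by
      have h : Tendsto (fun lam : ℝ => lam) (𝓝[>] 0) (𝓝 0) :=
        tendsto_id.mono_left nhdsWithin_le_nhds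
      simpa using h.const_mul M
    have hκ₀ : Tendsto κ (𝓝[>] 0) (𝓝 0) :=
      squeeze_zero' (hκp.mono fun _ h => h.1.le) (hκp.mono fun _ h => h.2.1) hid
    simpa using (hκ₀.pow 2).neg

/-- The square roots of threshold eigenvalues are small zeros of the Jost function. -/
theorem IsThresholdEigenvalue.jostFun_eq_zero (hℓ : 0 ≤ ℓ) (hU : MemLp U 2 volume)
    (hUs : EssSupportedIn U ℓ) (hVl : ∀ᶠ lam in 𝓝[>] (0 : ℝ), MemLp (Vl lam) 2 volume)
    (hVls : ∀ᶠ lam in 𝓝[>] (0 : ℝ), EssSupportedIn (Vl lam) ℓ)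
    (hv : Tendsto (fun lam => toSlab ℓ (Vl lam)) (𝓝[>] 0) (𝓝 v₀))
    (hq : IsUnit (1 - volterra ℓ (toSlab ℓ U)))
    (hu : Primitive ℓ 1 0 (fun t => toSlab ℓ U t * û t) û)
    (hu' : ∫ t, toSlab ℓ U t * û t ∂slab ℓ = 0) {e : ℝ → ℝ}
    (he : IsThresholdEigenvalue (fun lam x => U x + lam * Vl lam x) e) :
    Tendsto (fun lam => √(-e lam)) (𝓝[>] 0) (𝓝 0) ∧
      (∀ᶠ lam in 𝓝[>] (0 : ℝ), e lam = -√(-e lam) ^ 2) ∧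
      ∀ᶠ lam in 𝓝[>] (0 : ℝ),
        jostFun (toSlab ℓ U) (fun lam => toSlab ℓ (Vl lam)) û (lam, √(-e lam)) = 0 := by
  have hκ : Tendsto (fun lam => √(-e lam)) (𝓝[>] 0) (𝓝 0) := by
    simpa using (he.tendsto.neg).sqrt
  have hsq : ∀ᶠ lam in 𝓝[>] (0 : ℝ), e lam = -√(-e lam) ^ 2 := by
    filter_upwards [he.eigenvalue] with lam h
    rw [Real.sq_sqrt (by linarith [h.1]), neg_neg]
  refine ⟨hκ, hsq, ?_⟩
  have hp : Tendsto (fun lam => (lam, √(-e lam))) (𝓝[>] 0) (𝓝[>] (0 : ℝ) ×ˢ 𝓝 (0 : ℝ)) :=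
    tendsto_id.prodMk hκ
  filter_upwards [hp.eventually (eventually_isUnit_volterraOp hv hq), he.eigenvalue, hsq, hVl,
    hVls] with lam h₁ h₂ h₃ h₄ h₅
  have hev := h₂.2
  rw [h₃] at hev
  exact jostFun_eq_zero_of_eigenvalue hℓ hu hu' h₁ (Real.sqrt_pos.2 (by linarith [h₂.1]))
    (coeFn_toSlab_add_smul hU h₄) (essSupportedIn_add_mul hUs h₅) hev

end Family

theorem exists_common_support {U V V₁ : ℝ → ℝ} {Vl : ℝ → ℝ → ℝ}
    (hU : BoundedCompactlySupported U) (hV : BoundedCompactlySupported V)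
    (hV₁ : BoundedCompactlySupported V₁)
    (hVls : ∃ ℓ : ℝ, ∀ᶠ lam in 𝓝[>] (0 : ℝ), EssSupportedIn (Vl lam) ℓ) :
    ∃ ℓ : ℝ, 0 < ℓ ∧ EssSupportedIn U ℓ ∧ EssSupportedIn V ℓ ∧ EssSupportedIn V₁ ℓ ∧
      ∀ᶠ lam in 𝓝[>] (0 : ℝ), EssSupportedIn (Vl lam) ℓ := by
  obtain ⟨-, a, ha⟩ := hU
  obtain ⟨-, b, hb⟩ := hV
  obtain ⟨-, c, hc⟩ := hV₁
  obtain ⟨d, hd⟩ := hVls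
  have h₁ := le_abs_self a
  have h₂ := le_abs_self b
  have h₃ := le_abs_self c
  have h₄ := le_abs_self d
  have k₁ := abs_nonneg a
  have k₂ := abs_nonneg b
  have k₃ := abs_nonneg c
  have k₄ := abs_nonneg d
  exact ⟨|a| + |b| + |c| + |d| + 1, by positivity, ha.mono (by linarith), hb.mono (by linarith),
    hc.mono (by linarith), hd.mono fun _ h => h.mono (by linarith)⟩

section Correctors

variable {ℓ : ℝ} {U V u u₁ vs : ℝ → ℝ} {û w z : ℝ →ᵇ ℝ}

/-- The second solution `u₁` on the interval. -/
theorem primitive_second_solution (hℓ : 0 ≤ ℓ) (hU : MemLp U 2 volume)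
    (hUs : EssSupportedIn U ℓ) (hu₁ : IsSolution U 0 u₁) (hl : ∀ᶠ x in atBot, u₁ x = x)
    (hw : w = restr ℓ u₁ hu₁.differentiable.continuous) :
    Primitive ℓ (-ℓ) 1 (fun t => toSlab ℓ U t * w t) w ∧
      deriv u₁ ℓ = 1 + ∫ t, toSlab ℓ U t * w t ∂slab ℓ := by
  have hf : deriv (deriv u₁) =ᵐ[slab ℓ] fun t => toSlab ℓ U t * w t := by
    filter_upwards [ae_restrict_of_ae hu₁.ae_deriv_deriv_eq,
      coeFn_toSlab (ℓ := ℓ) hU, ae_slab_clamp ℓ] with t h₁ h₂ h₃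
    rw [h₁, h₂, hw, restr_apply, h₃]
    simp
  obtain ⟨e₁, e₂⟩ := hu₁.initial_values hUs essSupportedIn_zero (s := 1) (by simpa using hl)
  have h₁ := primitive_restr hu₁.differentiable hu₁.deriv_ac hℓ hf
  have h₂ := deriv_end_eq hu₁.deriv_ac hℓ hf
  rw [e₂, e₁, one_mul, ← hw] at h₁
  rw [e₂] at h₂
  exact ⟨h₁, h₂⟩

/-- The corrector `v_*` on the interval. -/
theorem primitive_corrector (hℓ : 0 ≤ ℓ) (hU : MemLp U 2 volume) (hV : MemLp V 2 volume)
    (hUs : EssSupportedIn U ℓ) (hVs : EssSupportedIn V ℓ) {hc : Continuous u}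
    (hû : û = restr ℓ u hc)
    (hvs : IsSolution U (fun x => -(V x * u x)) vs) (hl : ∀ᶠ x in atBot, vs x = 0)
    (hz : z = restr ℓ vs hvs.differentiable.continuous) :
    Primitive ℓ 0 0 (fun t => toSlab ℓ U t * z t + toSlab ℓ V t * û t) z := by
  have hf : deriv (deriv vs) =ᵐ[slab ℓ] fun t => toSlab ℓ U t * z t + toSlab ℓ V t * û t := by
    filter_upwards [ae_restrict_of_ae hvs.ae_deriv_deriv_eq,
      coeFn_toSlab (ℓ := ℓ) hU, coeFn_toSlab (ℓ := ℓ) hV, ae_slab_clamp ℓ] with t h₁ h₂ h₃ h₄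
    rw [h₁, h₂, h₃, hz, hû, restr_apply, restr_apply, h₄]
    ring
  have hs : EssSupportedIn (fun x => -(V x * u x)) ℓ := by
    filter_upwards [hVs] with x h hx
    rw [h hx, zero_mul, neg_zero]
  obtain ⟨e₁, e₂⟩ := hvs.initial_values hUs hs (s := 0) (by simpa using hl)
  have h₁ := primitive_restr hvs.differentiable hvs.deriv_ac hℓ hf
  rwa [e₂, e₁, zero_mul, neg_zero, ← hz] at h₁

variable {q v₀ : Lp ℝ 2 (slab ℓ)}

theorem eq_volterra_of_primitive_corrector
    (hz : Primitive ℓ 0 0 (fun t => q t * z t + v₀ t * û t) z) :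
    z = volterra ℓ v₀ û + volterra ℓ q z := by
  ext x
  rw [BoundedContinuousFunction.add_apply, hz.eq x, volterra_apply, volterra_apply,
    pairing_apply, pairing_apply, ← integral_add (integrable_Lp_mul v₀ (kern ℓ x * û))
      (integrable_Lp_mul q (kern ℓ x * z))]
  rw [zero_mul, add_zero, zero_add]
  refine integral_congr_ae (Eventually.of_forall fun t => ?_)
  simp only [BoundedContinuousFunction.mul_apply]
  ring

/-- The boundary values at `ℓ` of the second solution `w` and of the corrector `z`, from their
Wronskians with each other and with the half-bound state. -/
theorem boundary_values (hℓ : 0 ≤ ℓ) (hu : Primitive ℓ 1 0 (fun t => q t * û t) û)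
    (hu' : ∫ t, q t * û t ∂slab ℓ = 0) (hw : Primitive ℓ (-ℓ) 1 (fun t => q t * w t) w)
    (hz : Primitive ℓ 0 0 (fun t => q t * z t + v₀ t * û t) z) :
    (1 + ∫ t, q t * w t ∂slab ℓ) * û ℓ = 1 ∧
      z ℓ = w ℓ * pairing ℓ v₀ (û * û) - û ℓ * pairing ℓ v₀ (w * û) := by
  have hsymm : ∀ f g : ℝ →ᵇ ℝ, ∫ t, q t * f t * g t ∂slab ℓ = pairing ℓ q (f * g) :=
    fun f g => by
      rw [pairing_apply]
      exact integral_congr_ae (Eventually.of_forall fun t => by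
        simp only [BoundedContinuousFunction.mul_apply]; ring)
  have hinh : ∀ g : ℝ →ᵇ ℝ, ∫ t, (q t * z t + v₀ t * û t) * g t ∂slab ℓ
      = pairing ℓ q (z * g) + pairing ℓ v₀ (û * g) := fun g => by
    rw [pairing_apply, pairing_apply, ← integral_add (integrable_Lp_mul _ _)
      (integrable_Lp_mul _ _)]
    exact integral_congr_ae (Eventually.of_forall fun t => by
      simp only [BoundedContinuousFunction.mul_apply]; ring)
  have h₁ := hw.wronskian hℓ hu
  have h₂ := hz.wronskian hℓ hu
  have h₃ := hz.wronskian hℓ hw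
  rw [hsymm, hsymm, hu', mul_comm û w] at h₁
  rw [hinh, hsymm, hu', mul_comm û z] at h₂
  rw [hinh, hsymm, mul_comm w z, mul_comm û w] at h₃
  have h₄ : (1 + ∫ t, q t * w t ∂slab ℓ) * û ℓ = 1 := by linear_combination h₁
  refine ⟨h₄, ?_⟩
  linear_combination (-z ℓ) * h₄ + w ℓ * h₂ - û ℓ * h₃

end Correctors

end

theorem theorem1 (U V V₁ : ℝ → ℝ) (Vl : ℝ → ℝ → ℝ) (u : ℝ → ℝ)
    (hU : BoundedCompactlySupported U)
    (hV : BoundedCompactlySupported V)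
    (hV₁ : BoundedCompactlySupported V₁)
    (hVl : ∀ᶠ lam in 𝓝[>] (0 : ℝ), MemLp (Vl lam) 2 volume)
    (hVl_supp : ∃ ℓ : ℝ, ∀ᶠ lam in 𝓝[>] (0 : ℝ), EssSupportedIn (Vl lam) ℓ)
    (hVl_exp : (fun lam : ℝ =>
        (eLpNorm (fun x => Vl lam x - V x - lam * V₁ x) 2 volume).toReal)
          =o[𝓝[>] (0 : ℝ)] (fun lam : ℝ => lam))
    (hu : IsNormalizedHalfBoundState U u)
    (hneg : ∫ x, V x * u x ^ 2 < 0) :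
    (∃ e : ℝ → ℝ, IsThresholdEigenvalue (fun lam x => U x + lam * Vl lam x) e) ∧
    ∃ θ : ℝ, θ ≠ 0 ∧ Tendsto u atTop (𝓝 θ) ∧
      ∀ u₁ vs : ℝ → ℝ,
        IsSolution U 0 u₁ → (∀ᶠ x in atBot, u₁ x = x) →
        IsSolution U (fun x => -(V x * u x)) vs → (∀ᶠ x in atBot, vs x = 0) →
        ∃ θ₁ : ℝ, (∀ᶠ x in atTop, u₁ x = θ⁻¹ * x + θ₁) ∧
          ∀ e : ℝ → ℝ, IsThresholdEigenvalue (fun lam x => U x + lam * Vl lam x) e →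
            ∃ r : ℝ → ℝ, r =o[𝓝[>] (0 : ℝ)] (fun lam : ℝ => lam) ∧
              ∀ᶠ lam in 𝓝[>] (0 : ℝ),
                e lam = -lam ^ 2 * (omega0 V u θ + omega1 V V₁ u u₁ vs θ θ₁ * lam + r lam) ^ 2
  := by
  obtain ⟨ℓ, hℓ, hUs, hVs, hV₁s, hVls⟩ := exists_common_support hU hV hV₁ hVl_supp
  have hU₂ := hU.memLp_two
  have hV₂ := hV.memLp_two
  have hV₁₂ := hV₁.memLp_two
  obtain ⟨hv, hv₁⟩ := tendsto_toSlab (ℓ := ℓ) hV₂ hV₁₂ hVl hVl_exp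
  have hq := isUnit_one_sub_volterra_toSlab hℓ.le hU
  set û := restr ℓ u hu.solution.differentiable.continuous with hû
  obtain ⟨hup, hu'⟩ := primitive_halfBoundState hℓ.le hU hUs hu hû
  have hûx : ∀ x, û x = u (clamp ℓ x) := fun x => rfl
  have hcℓ : clamp ℓ ℓ = ℓ := clamp_of_mem (by linarith) le_rfl
  have hθ : û ℓ = u ℓ := by rw [hûx, hcℓ]
  have hA : pairing ℓ (toSlab ℓ V) (û * û) = ∫ x, V x * u x ^ 2 :=
    pairing_toSlab hV₂ hVs fun x => by rw [BoundedContinuousFunction.mul_apply, hûx]; ring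
  refine ⟨exists_isThresholdEigenvalue hℓ.le hU₂ hUs hVl hVls hv hq hup hu' (by rwa [hA]),
    u ℓ, hθ ▸ end_ne_zero hℓ.le hq hup hu', ?_, ?_⟩
  · exact tendsto_const_nhds.congr'
      ((eventually_ge_atTop ℓ).mono fun x hx => (hu.eq_right hUs hx).symm)
  intro u₁ vs hu₁ hu₁l hvs hvsl
  set w₁ := restr ℓ u₁ hu₁.differentiable.continuous with hw₁
  set z := restr ℓ vs hvs.differentiable.continuous with hz
  obtain ⟨hw₁p, hu₁'⟩ := primitive_second_solution hℓ.le hU₂ hUs hu₁ hu₁l hw₁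
  have hzp := primitive_corrector hℓ.le hU₂ hV₂ hUs hVs hû hvs hvsl hz
  obtain ⟨hslope, hzℓ⟩ := boundary_values hℓ.le hup hu' hw₁p hzp
  have hθ₀ : u ℓ ≠ 0 := hθ ▸ end_ne_zero hℓ.le hq hup hu'
  rw [← hu₁', hθ] at hslope
  have hslope' : deriv u₁ ℓ = (u ℓ)⁻¹ := eq_inv_of_mul_eq_one_left hslope
  refine ⟨u₁ ℓ - (u ℓ)⁻¹ * ℓ, ?_, fun e he => ?_⟩
  · filter_upwards [eventually_ge_atTop ℓ] with x hx
    rw [hu₁.affine_right hUs essSupportedIn_zero hx, hslope']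
    ring
  obtain ⟨hκ, hsq, hjost⟩ := he.jostFun_eq_zero hℓ.le hU₂ hUs hVl hVls hv hq hup hu'
  set κ : ℝ → ℝ := fun lam => √(-e lam) with hκdef
  have huq : û = 1 + volterra ℓ (toSlab ℓ U) û := by
    have h := eq_of_primitive (EventuallyEq.refl _ _) hup
    rwa [one_smul, zero_smul, add_zero] at h
  -- The solution of the unperturbed equation with vanishing value and unit slope at `-ℓ`.
  have hw : w₁ + ℓ • û = ramp ℓ + volterra ℓ (toSlab ℓ U) (w₁ + ℓ • û) := by
    have h := eq_of_primitive (EventuallyEq.refl _ _) hw₁p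
    rw [map_add, map_smul]
    nth_rw 1 [h, huq]
    rw [smul_add, neg_smul, one_smul]
    abel
  have hlim := tendsto_zero_second hv hq huq hκ hjost hv₁ hw
    (eq_volterra_of_primitive_corrector hzp) rfl
  set Ω₀ := omega0 V u (u ℓ) with hΩ₀
  set Ω₁ := omega1 V V₁ u u₁ vs (u ℓ) (u₁ ℓ - (u ℓ)⁻¹ * ℓ) with hΩ₁
  have hA' : pairing ℓ (toSlab ℓ V) (û * û) = Ω₀ * (u ℓ ^ 2 + 1) := by
    rw [hA, hΩ₀, omega0]
    field_simp
  have hm : -pairing ℓ (toSlab ℓ V) (û * û) / (1 + û ℓ ^ 2) = -Ω₀ := by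
    rw [hA', hθ]
    field_simp
    ring
  have hI₁ : ∫ x, V x * (vs x + Ω₀ * (u ℓ ^ 2 - 1) * u₁ x) * u x
      = pairing ℓ (toSlab ℓ V) (z * û)
        + Ω₀ * (u ℓ ^ 2 - 1) * pairing ℓ (toSlab ℓ V) (w₁ * û) := by
    have h := pairing_toSlab hV₂ hVs (g := z * û + (Ω₀ * (u ℓ ^ 2 - 1)) • (w₁ * û))
      (h := fun x => (vs x + Ω₀ * (u ℓ ^ 2 - 1) * u₁ x) * u x) fun x => by
        simp only [BoundedContinuousFunction.add_apply, BoundedContinuousFunction.smul_apply,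
          BoundedContinuousFunction.mul_apply, hz, hw₁, hû, restr_apply, smul_eq_mul]
        ring
    rw [map_add, map_smul, smul_eq_mul] at h
    rw [h]
    exact integral_congr_ae (Eventually.of_forall fun x => by simp only; ring)
  have hI₂ := integral_sq_sub_stepTheta hℓ hûx (fun x hx => hu.eq_left hUs hx)
    (fun x hx => hu.eq_right hUs hx)
  have hI₃ : pairing ℓ (toSlab ℓ V₁) (û * û) = ∫ x, V₁ x * u x ^ 2 :=
    pairing_toSlab hV₁₂ hV₁s fun x => by rw [BoundedContinuousFunction.mul_apply, hûx]; ring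
  have hw₁ℓ : w₁ ℓ = u₁ ℓ := by rw [hw₁, restr_apply, hcℓ]
  have hΩ₁' : Ω₁ * (u ℓ ^ 2 + 1) = pairing ℓ (toSlab ℓ V) (z * û)
        + Ω₀ * (u ℓ ^ 2 - 1) * pairing ℓ (toSlab ℓ V) (w₁ * û)
      + Ω₀ ^ 2 * (pairing ℓ (oneLp ℓ) (û * û) - ℓ * (1 + u ℓ ^ 2))
      - Ω₀ ^ 2 * u ℓ ^ 3 * (u₁ ℓ - (u ℓ)⁻¹ * ℓ) + pairing ℓ (toSlab ℓ V₁) (û * û) := by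
    rw [hΩ₁, omega1, ← hΩ₀, hI₁, hI₂, hI₃]
    field_simp
  have hθcancel : u ℓ ^ 3 * (u ℓ)⁻¹ = u ℓ ^ 2 := by field_simp
  rw [hm] at hlim
  have hval : -(-Ω₀ * (û ℓ * (-Ω₀ * (w₁ + ℓ • û) ℓ + z ℓ)
        + -Ω₀ * pairing ℓ (oneLp ℓ) (û * û))
      + (pairing ℓ (toSlab ℓ V) ((-Ω₀ • (w₁ + ℓ • û) + z) * û)
        + pairing ℓ (toSlab ℓ V₁) (û * û))) / (1 + û ℓ ^ 2) = -Ω₁ := by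
    rw [div_eq_iff (by positivity)]
    simp only [BoundedContinuousFunction.add_apply, BoundedContinuousFunction.smul_apply,
      add_mul, smul_mul_assoc, map_add, map_smul, smul_add, smul_eq_mul]
    rw [hzℓ, hw₁ℓ, hθ, hA']
    linear_combination hΩ₁' + Ω₀ ^ 2 * ℓ * hθcancel
  rw [hval] at hlim
  refine ⟨fun lam => -(κ lam / lam) - Ω₀ - Ω₁ * lam, ?_, ?_⟩
  · have hpos : ∀ᶠ lam in 𝓝[>] (0 : ℝ), lam ≠ 0 :=
      (eventually_mem_of_tendsto_nhdsWithin (s := Set.Ioi 0) tendsto_id).mono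
        fun _ h => ne_of_gt h
    refine (isLittleO_iff_tendsto' (hpos.mono fun lam h h₀ => absurd h₀ h)).2 ?_
    have h := (hlim.add_const Ω₁).neg
    rw [neg_add_cancel, neg_zero] at h
    refine h.congr' ?_
    filter_upwards [hpos] with lam hlam
    field_simp
    ring
  · filter_upwards [hsq, self_mem_nhdsWithin] with lam h₁ h₂
    have hlam : lam ≠ 0 := ne_of_gt h₂
    rw [h₁]
    change -κ lam ^ 2 = _
    field_simp
    ring
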